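/- Let $a,b\ge 0$ and let $n$ be a measure on $(0,\infty)$ with $\int\min\{y^2,y\}\,n(dy)<\infty$; put $\tilde n(dy)=n([y,\infty))\,dy$ on $(0,\infty)$ and $$\Phi(\lambda)=\int_0^\lambda\frac{du}{au+b+\int(1-e^{-uy})\,\tilde n(dy)}\in[0,\infty],\qquad \lambda\ge0$$ (with $1/0=\infty$). Suppose that $\Phi(1)<\infty$ and that $\Phi(\lambda)=\int(1-e^{-\lambda y})\,\Lambda(dy)$ for all $\lambda\ge 0$, where $\Lambda$ is a measure on $(0,\infty)$ with $\int\min\{1,y\}\,\Lambda(dy)<\infty$ (that is, the translation term $q$ vanishes). For $\delta>0$ let $\nu_\delta$ be the probability measure on $[0,\infty)$ with $\int e^{-\lambda x}\,\nu_\delta(dx)=e^{-\delta\Phi(\lambda)}$, $\lambda\ge0$; write $\langle\cdot\rangle_\delta$ for the integral with respect to $\nu_\delta$. Let $\mathcal F_0$ be the linear hull of the functions $x\mapsto e^{-\lambda x}$, $\lambda\ge0$, and for $f,g\in\mathcal F_0$ put $$B_\delta(f,g)=\Big\langle x\int\tilde n(dy)\,f'(x+y)\,(g(x+y)-g(x))\Big\rangle_\delta,\qquad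 B_0(f,g)=\int\Lambda(dx)\,x\int\tilde n(dy)\,f'(x+y)\,(g(x+y)-g(x)).$$ Then, for every fixed $0<C<\infty$, the following two conditions are equivalent. (i) For all $\delta>0$ and all $f,g\in\mathcal F_0$, $$B_\delta(f,g)^2\le C\,\langle xf'(x)^2\rangle_\delta\,\Big\langle x\int n(dy)\,(g(x+y)-g(x))^2\Big\rangle_\delta .\tag{3.9}$$ (ii) For all $f,g\in\mathcal F_0$, $$B_0(f,g)^2\le C\int\Lambda(dx)\,xf'(x)^2\cdot\int\Lambda(dx)\,x\int n(dy)\,(g(x+y)-g(x))^2 .\tag{3.10}$$ Moreover, if $a>0$ and if, for some $\delta>0$, (3.9) holds for all $f,g\in\mathcal F_0$, then for this $\delta$ $$\mathrm{Sect}(\mathcal E^\delta)\le 1+\sqrt{2C/a}.$$ Here $L_\delta$, with domain $D(L_\delta)$, is the generator of the CBCI-process (continuous state branching process with continuous immigration) with quadruplet $(a,b,n,\delta)$, that is, of the conservative Markov process on $[0,\infty)$ whose transition semigroup is strongly continuous on $C([0,\infty])$ (the continuous functions on $[0,\infty)$ with a finite limit at infinity, with the supremum norm) and whose generator satisfies $\mathcal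 F_0\subset D(L_\delta)$ and $$L_\delta f(x)=axf''(x)-bxf'(x)+x\int[f(x+y)-f(x)-yf'(x)]\,n(dy)+\delta f'(x),\qquad f\in\mathcal F_0;$$ $\mathcal E^\delta(f,g)=-\int L_\delta f(x)\,g(x)\,\nu_\delta(dx)$ for $f,g\in D(L_\delta)$; and $\mathrm{Sect}(\mathcal E^\delta)\in[0,\infty]$ is the infimum of the constants $K\ge 0$ with $\mathcal E^\delta(f,g)\le K\,\mathcal E^\delta(f,f)^{1/2}\,\mathcal E^\delta(g,g)^{1/2}$ for all $f,g\in D(L_\delta)$ ($\infty$ if there is none). -/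

import Mathlib

open MeasureTheory ProbabilityTheory Filter Topology Set
open scoped NNReal ENNReal

namespace CBCI

noncomputable section

/-! ### Parameters -/

/-- The standing assumptions on the branching parameters `(a, b, n)`: `a, b ≥ 0`, and `n` is a
measure on `(0, ∞)` (a measure on `ℝ` that does not charge `(-∞, 0]`) with
`∫ min (y ^ 2) y n(dy) < ∞`. -/
structure IsBranchingData (a b : ℝ) (n : Measure ℝ) : Prop where
  a_nonneg : 0 ≤ a
  b_nonneg : 0 ≤ b
  null_nonpos : n (Iic 0) = 0
  lintegral_lt_top : ∫⁻ y, ENNReal.ofReal (min (y ^ 2) y) ∂n < ⊤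

/-- A Lévy measure (of a subordinator): a measure `Λ` on `(0, ∞)` with
`∫ min 1 y Λ(dy) < ∞`. -/
structure IsLevyMeasure (Λ : Measure ℝ) : Prop where
  null_nonpos : Λ (Iic 0) = 0
  lintegral_lt_top : ∫⁻ y, ENNReal.ofReal (min 1 y) ∂Λ < ⊤

/-- The integrated tail `ñ(dy) = n([y, ∞)) dy` on `(0, ∞)`. -/
def tailMeasure (n : Measure ℝ) : Measure ℝ :=
  (volume.restrict (Ioi 0)).withDensity fun y => n (Ici y)

/-- `a u + b + ∫ (1 - e^{-uy}) ñ(dy)`. -/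
def branchingSymbol (a b : ℝ) (n : Measure ℝ) (u : ℝ) : ℝ :=
  a * u + b + ∫ y, (1 - Real.exp (-(u * y))) ∂(tailMeasure n)

/-- `Φ(l) = ∫_0^l du / (a u + b + ∫ (1 - e^{-uy}) ñ(dy))`, with values in `[0, ∞]`. -/
def laplaceExponent (a b : ℝ) (n : Measure ℝ) (l : ℝ) : ℝ≥0∞ :=
  ∫⁻ u in Ioc 0 l, (ENNReal.ofReal (branchingSymbol a b n u))⁻¹

/-- `μ` is the probability measure on `[0, ∞)` with Laplace exponent `φ`. -/
def HasLaplaceExponent (μ : Measure ℝ≥0) (φ : ℝ → ℝ) : Prop :=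
  IsProbabilityMeasure μ ∧
    ∀ l : ℝ, 0 ≤ l → ∫ x, Real.exp (-(l * (x : ℝ))) ∂μ = Real.exp (-φ l)

/-! ### Exponential functions and the bilinear forms `B` -/

/-- The linear hull of the functions `x ↦ e^{-lx}`, `l ≥ 0`. -/
def expSpan : Submodule ℝ (ℝ → ℝ) :=
  Submodule.span ℝ {f | ∃ l : ℝ, 0 ≤ l ∧ f = fun x => Real.exp (-(l * x))}

/-- `∫ ρ(dx) x ∫ ñ(dy) f'(x + y) (g(x + y) - g(x))`. -/
def formB (n ρ : Measure ℝ) (f g : ℝ → ℝ) : ℝ :=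
  ∫ x, x * ∫ y, deriv f (x + y) * (g (x + y) - g x) ∂(tailMeasure n) ∂ρ

/-- `∫ ρ(dx) x f'(x) ^ 2`. -/
def gradientEnergy (ρ : Measure ℝ) (f : ℝ → ℝ) : ℝ :=
  ∫ x, x * deriv f x ^ 2 ∂ρ

/-- `∫ ρ(dx) x ∫ n(dy) (g(x + y) - g(x)) ^ 2`. -/
def jumpEnergy (n ρ : Measure ℝ) (g : ℝ → ℝ) : ℝ :=
  ∫ x, x * ∫ y, (g (x + y) - g x) ^ 2 ∂n ∂ρ

/-- The Cauchy–Schwarz type bound with constant `C` for the form `B` with respect to `ρ`. -/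
def CauchySchwarzBound (n ρ : Measure ℝ) (C : ℝ) : Prop :=
  ∀ f ∈ expSpan, ∀ g ∈ expSpan,
    formB n ρ f g ^ 2 ≤ C * gradientEnergy ρ f * jumpEnergy n ρ g

/-- A measure on `[0, ∞)` regarded as a measure on `ℝ`. -/
def toLine (μ : Measure ℝ≥0) : Measure ℝ :=
  μ.map fun x : ℝ≥0 => (x : ℝ)

/-! ### Feller semigroups on `[0, ∞]` and their generators -/

/-- `f ∈ C([0, ∞])`: `f` is continuous on `[0, ∞)` and has a finite limit at infinity. -/
def IsContExt (f : ℝ≥0 → ℝ) : Prop :=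
  Continuous f ∧ ∃ l : ℝ, Tendsto f atTop (𝓝 l)

/-- `T_t f (x) = ∫ f(y) P_t(x, dy)`. -/
def semigroupOp (P : ℝ≥0 → Kernel ℝ≥0 ℝ≥0) (t : ℝ≥0) (f : ℝ≥0 → ℝ) (x : ℝ≥0) : ℝ :=
  ∫ y, f y ∂(P t x)

/-- `P` is the transition function of a conservative Markov process on `[0, ∞)` whose semigroup
is a strongly continuous semigroup on `C([0, ∞])` with the supremum norm. -/
structure IsFellerTransition (P : ℝ≥0 → Kernel ℝ≥0 ℝ≥0) : Prop where
  markov : ∀ t, IsMarkovKernel (P t)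
  zero : P 0 = Kernel.id
  add : ∀ s t, P (s + t) = P t ∘ₖ P s
  feller : ∀ t f, IsContExt f → IsContExt (semigroupOp P t f)
  strongly_continuous : ∀ f, IsContExt f →
    TendstoUniformly (fun t => semigroupOp P t f) f (𝓝[>] 0)

/-- The domain of the (strong) generator on `C([0, ∞])`: those `f` for which
`(T_t f - f) / t` converges uniformly as `t ↓ 0`. -/
def generatorDomain (P : ℝ≥0 → Kernel ℝ≥0 ℝ≥0) : Set (ℝ≥0 → ℝ) :=
  {f | IsContExt f ∧ ∃ h : ℝ≥0 → ℝ,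
    TendstoUniformly (fun (t : ℝ≥0) x => (semigroupOp P t f x - f x) / (t : ℝ)) h (𝓝[>] 0)}

/-- The generator; it is meant for `f` in `generatorDomain P`. -/
def generator (P : ℝ≥0 → Kernel ℝ≥0 ℝ≥0) (f : ℝ≥0 → ℝ) (x : ℝ≥0) : ℝ :=
  limUnder (𝓝[>] (0 : ℝ≥0)) fun t => (semigroupOp P t f x - f x) / (t : ℝ)

/-- The operator
`L f(x) = a x f''(x) - b x f'(x) + x ∫ (f(x + y) - f(x) - y f'(x)) n(dy) + δ f'(x)`. -/
def cbciOperator (a b : ℝ) (n : Measure ℝ) (δ : ℝ) (f : ℝ → ℝ) (x : ℝ) : ℝ :=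
  a * x * iteratedDeriv 2 f x - b * x * deriv f x
    + x * (∫ y, (f (x + y) - f x - y * deriv f x) ∂n) + δ * deriv f x

/-- `P` is the transition function of the CBCI-process with quadruplet `(a, b, n, δ)`: the Feller
process on `[0, ∞)` whose generator is `cbciOperator a b n δ` on the linear hull of the
functions `x ↦ e^{-lx}`, `l ≥ 0`. -/
structure IsCBCITransition (a b : ℝ) (n : Measure ℝ) (δ : ℝ)
    (P : ℝ≥0 → Kernel ℝ≥0 ℝ≥0) : Prop where
  isFeller : IsFellerTransition P
  mem_domain : ∀ f ∈ expSpan, (fun x : ℝ≥0 => f x) ∈ generatorDomain P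
  generator_eq : ∀ f ∈ expSpan, ∀ x : ℝ≥0,
    generator P (fun x : ℝ≥0 => f x) x = cbciOperator a b n δ f x

/-! ### The sector constant -/

/-- `ℰ(f, g) = - ∫ L f(x) g(x) μ(dx)`. -/
def energyForm (P : ℝ≥0 → Kernel ℝ≥0 ℝ≥0) (μ : Measure ℝ≥0) (f g : ℝ≥0 → ℝ) : ℝ :=
  -∫ x, generator P f x * g x ∂μ

/-- The sector constant of a form `E` on a domain `D`: the infimum in `[0, ∞]` of the finite
constants `C` with `E(f, g) ≤ C E(f, f)^{1/2} E(g, g)^{1/2}` for all `f, g ∈ D`; it is `∞` if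
there is no such constant. -/
def sectorConstant (D : Set (ℝ≥0 → ℝ)) (E : (ℝ≥0 → ℝ) → (ℝ≥0 → ℝ) → ℝ) : ℝ≥0∞ :=
  ⨅ (C : ℝ≥0) (_ : ∀ f ∈ D, ∀ g ∈ D, E f g ≤ C * √(E f f) * √(E g g)), (C : ℝ≥0∞)

end

end CBCI

/-!
Write `ψ` for the branching symbol, `s = l + m` and `e_l (x) = e^{-lx}`. On exponentials all forms
are explicit: with `M_ρ(s) = ∫ x e^{-sx} ρ(dx)`, the forms `B`, `⟨x f' g'⟩` and the jump energy have
the kernels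
`l (ψ̂(s) - ψ̂(l)) M_ρ(s)`, `l m M_ρ(s)` and `(∫ (1 - e^{-ly}) (1 - e^{-my}) n(dy)) M_ρ(s)`,
where `ψ̂` is the jump part of `ψ` (`formB_expSum`, `gradientEnergy_expSum`, `jumpEnergy_expSum`).
Only `M_ρ` depends on `ρ`, and differentiating the Laplace transforms gives `M_Λ = Φ' = 1 / ψ` and
`M_{ν_δ}(s) = δ e^{-δΦ(s)} M_Λ(s)` (`isTilted`).

The equivalence of the two bounds rests on the last relation. Dividing by `δ` and letting `δ → 0`
turns the forms of `ν_δ` into those of `Λ` (`bound_levy`). Conversely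
`e^{-δΦ(l + m)} = ∫ e^{-lz} e^{-mz} ν_δ(dz)`, so the forms of `ν_δ` are `δ` times the
`ν_δ(dz)`-averages of the forms of `Λ` at the translates `f (· + z)`, `g (· + z)`, and the bound
passes through the average by the Cauchy–Schwarz inequality (`bound_of_bound_levy`).

For the sector constant, `L e_l = (x l ψ(l) - δ l) e_l` and `M_{ν_δ} ψ = δ e^{-δΦ}` give
`ℰ(f, g) = a ⟨x f' g'⟩ + B(f, g)` on sums of exponentials (`energyForm_eq`); the symmetric part of
`B` is half of the jump energy (`two_mul_formB`), and the bound on `B` yields the sector inequality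
with the constant `1 + √(2C / a)` (`energyForm_le`).

It extends to the whole domain because sums of exponentials form a core. By dissipativity
(`abs_sub_le`) it suffices that `1 - L` maps them onto a dense subspace of `C([0, ∞])`. With
`V' / V = (1 + δ u) / (u ψ(u))` one has `d/du (V e_u) = V / (u ψ(u)) (1 - L) e_u`, while
`V e_u → 0` as `u → 0` because `∫_0 du / (u ψ(u))` diverges. So a functional that vanishes on the
range of `1 - L` vanishes on all exponentials (`expFun_mem_resolventClosure`), and these span a
dense subspace by the Weierstrass theorem in the variable `e^{-x}`.
-/

namespace CBCI

/-! ### The integrated tail and the branching symbol -/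

section

/-- The jump part `∫ (1 - e^{-uy}) ñ(dy)` of the branching symbol. -/
noncomputable def tailExponent (n : Measure ℝ) (u : ℝ) : ℝ :=
  ∫ y, (1 - Real.exp (-(u * y))) ∂(tailMeasure n)

lemma branchingSymbol_eq (a b : ℝ) (n : Measure ℝ) (u : ℝ) :
    branchingSymbol a b n u = a * u + b + tailExponent n u := rfl

lemma ae_pos_of_null {μ : Measure ℝ} (h : μ (Iic 0) = 0) : ∀ᵐ y ∂μ, 0 < y := by
  rw [ae_iff]
  simpa [Iic, not_lt] using h

lemma tailMeasure_Iic (n : Measure ℝ) : tailMeasure n (Iic 0) = 0 := by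
  refine withDensity_absolutelyContinuous _ _ ?_
  rw [Measure.restrict_apply measurableSet_Iic, Iic_inter_Ioi, Ioc_self, measure_empty]

lemma ae_pos_tailMeasure (n : Measure ℝ) : ∀ᵐ y ∂(tailMeasure n), 0 < y :=
  ae_pos_of_null (tailMeasure_Iic n)

/-- Integration against the integrated tail is integration of the primitive against `n`: this is
the layer cake formula. -/
lemma lintegral_tailMeasure {n : Measure ℝ} (hn : n (Iic 0) = 0) {g : ℝ → ℝ}
    (hg : Continuous g) (hg0 : ∀ t, 0 < t → 0 ≤ g t) :
    ∫⁻ y, ENNReal.ofReal (g y) ∂(tailMeasure n)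
      = ∫⁻ z, ENNReal.ofReal (∫ t in (0 : ℝ)..z, g t) ∂n := by
  have hmeas : Measurable fun y : ℝ => n (Ici y) :=
    Antitone.measurable fun x y hxy => measure_mono (Ici_subset_Ici.2 hxy)
  rw [tailMeasure, lintegral_withDensity_eq_lintegral_mul _ hmeas
    (g := fun y => ENNReal.ofReal (g y)) (ENNReal.measurable_ofReal.comp hg.measurable)]
  have := lintegral_comp_eq_lintegral_meas_le_mul (f := fun z : ℝ => z) (g := g) n
    ((ae_pos_of_null hn).mono fun y hy => hy.le) aemeasurable_id
    (fun t _ => hg.intervalIntegrable _ _)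
    ((ae_restrict_iff' measurableSet_Ioi).2 (ae_of_all _ fun t ht => hg0 t ht))
  rw [this]
  rfl

lemma one_sub_exp_nonneg {u y : ℝ} (hu : 0 ≤ u) (hy : 0 ≤ y) :
    0 ≤ 1 - Real.exp (-(u * y)) := by
  rw [sub_nonneg, Real.exp_le_one_iff, neg_nonpos]
  positivity

lemma compensated_nonneg (w : ℝ) : 0 ≤ Real.exp (-w) - 1 + w := by
  linarith [Real.add_one_le_exp (-w)]

lemma compensated_le_sq {w : ℝ} (hw : 0 ≤ w) : Real.exp (-w) - 1 + w ≤ w ^ 2 := by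
  have h1 : Real.exp (-w) ≤ (1 + w)⁻¹ := by
    rw [Real.exp_neg]
    exact inv_anti₀ (by linarith) (by linarith [Real.add_one_le_exp w])
  have h2 : (1 + w)⁻¹ ≤ 1 - w + w ^ 2 := by
    rw [inv_le_iff_one_le_mul₀ (by linarith)]
    nlinarith [pow_nonneg hw 3]
  linarith

variable {a b : ℝ} {n Λ : Measure ℝ}

lemma IsBranchingData.integrable_min (h : IsBranchingData a b n) :
    Integrable (fun y : ℝ => min (y ^ 2) y) n := by
  refine (lintegral_ofReal_ne_top_iff_integrable (by fun_prop) ?_).1 h.lintegral_lt_top.ne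
  filter_upwards [ae_pos_of_null h.null_nonpos] with y hy
  exact le_min (by positivity) hy.le

lemma IsBranchingData.integrable_compensated (h : IsBranchingData a b n) {u : ℝ} (hu : 0 ≤ u) :
    Integrable (fun y : ℝ => Real.exp (-(u * y)) - 1 + u * y) n := by
  refine (h.integrable_min.const_mul (u ^ 2 + u)).mono' (by fun_prop) ?_
  filter_upwards [ae_pos_of_null h.null_nonpos] with y hy
  have huy : 0 ≤ u * y := by positivity
  rw [Real.norm_of_nonneg (compensated_nonneg _)]
  rcases le_total y 1 with h1 | h1
  · rw [min_eq_left (by nlinarith)]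
    nlinarith [compensated_le_sq huy, mul_nonneg hu (sq_nonneg y)]
  · rw [min_eq_right (by nlinarith)]
    have : Real.exp (-(u * y)) ≤ 1 := by simpa using huy
    nlinarith [mul_nonneg (sq_nonneg u) hy.le]

lemma integral_mul_one_sub_exp (u z : ℝ) :
    ∫ t in (0 : ℝ)..z, u * (1 - Real.exp (-(u * t))) = Real.exp (-(u * z)) - 1 + u * z := by
  have hd : ∀ t ∈ uIcc 0 z, HasDerivAt (fun t : ℝ => Real.exp (-(u * t)) + u * t)
      (u * (1 - Real.exp (-(u * t)))) t := by
    intro t _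
    have h1 : HasDerivAt (fun t : ℝ => -(u * t)) (-(u * 1)) t :=
      ((hasDerivAt_id t).const_mul u).neg
    have h2 : HasDerivAt (fun t : ℝ => u * t) (u * 1) t := (hasDerivAt_id t).const_mul u
    refine (h1.exp.add h2).congr_deriv ?_
    ring
  rw [intervalIntegral.integral_eq_sub_of_hasDerivAt hd
    (Continuous.intervalIntegrable (by fun_prop) _ _)]
  simp only [mul_zero, neg_zero, Real.exp_zero]
  ring

lemma IsBranchingData.lintegral_tail (h : IsBranchingData a b n) {u : ℝ} (hu : 0 ≤ u) :
    ∫⁻ y, ENNReal.ofReal (u * (1 - Real.exp (-(u * y)))) ∂(tailMeasure n)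
      = ∫⁻ y, ENNReal.ofReal (Real.exp (-(u * y)) - 1 + u * y) ∂n := by
  rw [lintegral_tailMeasure h.null_nonpos (by fun_prop)
    fun t ht => mul_nonneg hu (one_sub_exp_nonneg hu ht.le)]
  simp_rw [integral_mul_one_sub_exp]

lemma IsBranchingData.integrable_tail (h : IsBranchingData a b n) {u : ℝ} (hu : 0 ≤ u) :
    Integrable (fun y : ℝ => 1 - Real.exp (-(u * y))) (tailMeasure n) := by
  rcases hu.eq_or_lt with rfl | hu'
  · simp
  have hi : Integrable (fun y : ℝ => u * (1 - Real.exp (-(u * y)))) (tailMeasure n) := by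
    refine (lintegral_ofReal_ne_top_iff_integrable (by fun_prop) ?_).1 ?_
    · filter_upwards [ae_pos_tailMeasure n] with y hy
      exact mul_nonneg hu (one_sub_exp_nonneg hu hy.le)
    · rw [h.lintegral_tail hu]
      exact (lintegral_ofReal_ne_top_iff_integrable (by fun_prop)
        (ae_of_all _ fun y => compensated_nonneg _)).2 (h.integrable_compensated hu)
  exact (integrable_const_mul_iff (Ne.isUnit hu'.ne') _).1 hi

/-- The jump part of the branching mechanism `u ↦ u ψ(u)` in terms of `n` itself. -/
lemma IsBranchingData.mul_tailExponent (h : IsBranchingData a b n) {u : ℝ} (hu : 0 ≤ u) :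
    u * tailExponent n u = ∫ y, (Real.exp (-(u * y)) - 1 + u * y) ∂n := by
  rw [tailExponent, ← integral_const_mul, integral_eq_lintegral_of_nonneg_ae ?_ (by fun_prop),
    integral_eq_lintegral_of_nonneg_ae (ae_of_all _ fun y => compensated_nonneg _) (by fun_prop),
    h.lintegral_tail hu]
  filter_upwards [ae_pos_tailMeasure n] with y hy
  exact mul_nonneg hu (one_sub_exp_nonneg hu hy.le)

lemma exp_mul_one_sub_exp (l m y : ℝ) :
    Real.exp (-(l * y)) * (1 - Real.exp (-(m * y)))
      = (1 - Real.exp (-((l + m) * y))) - (1 - Real.exp (-(l * y))) := by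
  have : -((l + m) * y) = -(l * y) + -(m * y) := by ring
  rw [this, Real.exp_add]
  ring

lemma IsBranchingData.integrable_exp_mul_tail (h : IsBranchingData a b n) {l m : ℝ}
    (hl : 0 ≤ l) (hm : 0 ≤ m) :
    Integrable (fun y : ℝ => Real.exp (-(l * y)) * (1 - Real.exp (-(m * y))))
      (tailMeasure n) := by
  simp_rw [exp_mul_one_sub_exp]
  exact (h.integrable_tail (add_nonneg hl hm)).sub (h.integrable_tail hl)

lemma IsBranchingData.integral_exp_mul_tail (h : IsBranchingData a b n) {l m : ℝ}
    (hl : 0 ≤ l) (hm : 0 ≤ m) :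
    ∫ y, Real.exp (-(l * y)) * (1 - Real.exp (-(m * y))) ∂(tailMeasure n)
      = tailExponent n (l + m) - tailExponent n l := by
  simp_rw [exp_mul_one_sub_exp]
  exact integral_sub (h.integrable_tail (add_nonneg hl hm)) (h.integrable_tail hl)

lemma one_sub_exp_mul_one_sub_exp (l m y : ℝ) :
    (1 - Real.exp (-(l * y))) * (1 - Real.exp (-(m * y)))
      = (Real.exp (-((l + m) * y)) - 1 + (l + m) * y) - (Real.exp (-(l * y)) - 1 + l * y)
        - (Real.exp (-(m * y)) - 1 + m * y) := by
  have : -((l + m) * y) = -(l * y) + -(m * y) := by ring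
  rw [this, Real.exp_add]
  ring

lemma IsBranchingData.integrable_one_sub_exp_mul (h : IsBranchingData a b n) {l m : ℝ}
    (hl : 0 ≤ l) (hm : 0 ≤ m) :
    Integrable (fun y : ℝ => (1 - Real.exp (-(l * y))) * (1 - Real.exp (-(m * y)))) n := by
  simp_rw [one_sub_exp_mul_one_sub_exp]
  exact ((h.integrable_compensated (add_nonneg hl hm)).sub (h.integrable_compensated hl)).sub
    (h.integrable_compensated hm)

/-- The kernel `∫ (1 - e^{-ly}) (1 - e^{-my}) n(dy)` is the second difference of the jump part of
the branching mechanism. -/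
lemma IsBranchingData.integral_one_sub_exp_mul (h : IsBranchingData a b n) {l m : ℝ}
    (hl : 0 ≤ l) (hm : 0 ≤ m) :
    ∫ y, (1 - Real.exp (-(l * y))) * (1 - Real.exp (-(m * y))) ∂n
      = (l + m) * tailExponent n (l + m) - l * tailExponent n l - m * tailExponent n m := by
  rw [h.mul_tailExponent hl, h.mul_tailExponent hm, h.mul_tailExponent (add_nonneg hl hm)]
  simp_rw [one_sub_exp_mul_one_sub_exp]
  rw [← integral_sub (h.integrable_compensated (add_nonneg hl hm)) (h.integrable_compensated hl)]
  exact integral_sub ((h.integrable_compensated (add_nonneg hl hm)).sub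
    (h.integrable_compensated hl)) (h.integrable_compensated hm)

lemma IsBranchingData.tailExponent_mono (h : IsBranchingData a b n) {u v : ℝ} (hu : 0 ≤ u)
    (huv : u ≤ v) : tailExponent n u ≤ tailExponent n v := by
  refine integral_mono_ae (h.integrable_tail hu) (h.integrable_tail (hu.trans huv)) ?_
  filter_upwards [ae_pos_tailMeasure n] with y hy
  have : Real.exp (-(v * y)) ≤ Real.exp (-(u * y)) := by
    gcongr
  linarith

lemma tailExponent_nonneg {u : ℝ} (hu : 0 ≤ u) : 0 ≤ tailExponent n u := by
  refine integral_nonneg_of_ae ?_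
  filter_upwards [ae_pos_tailMeasure n] with y hy
  exact one_sub_exp_nonneg hu hy.le

lemma IsBranchingData.continuousAt_tailExponent (h : IsBranchingData a b n) {u : ℝ}
    (hu : 0 < u) : ContinuousAt (tailExponent n) u := by
  refine continuousAt_of_dominated (bound := fun y => 1 - Real.exp (-((u + 1) * y)))
    (Eventually.of_forall fun v => by fun_prop) ?_ (h.integrable_tail (by positivity))
    (ae_of_all _ fun y => by fun_prop)
  filter_upwards [Ioo_mem_nhds hu (lt_add_one u)] with v hv
  filter_upwards [ae_pos_tailMeasure n] with y hy
  rw [Real.norm_of_nonneg (one_sub_exp_nonneg hv.1.le hy.le)]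
  have : Real.exp (-((u + 1) * y)) ≤ Real.exp (-(v * y)) := by
    have := hv.2.le
    gcongr
  linarith

lemma IsBranchingData.branchingSymbol_nonneg (h : IsBranchingData a b n) {u : ℝ} (hu : 0 ≤ u) :
    0 ≤ branchingSymbol a b n u := by
  have := tailExponent_nonneg (n := n) hu
  have := h.a_nonneg
  have := h.b_nonneg
  rw [branchingSymbol_eq]
  positivity

lemma IsBranchingData.branchingSymbol_mono (h : IsBranchingData a b n) {u v : ℝ} (hu : 0 ≤ u)
    (huv : u ≤ v) : branchingSymbol a b n u ≤ branchingSymbol a b n v := by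
  rw [branchingSymbol_eq, branchingSymbol_eq]
  have := h.tailExponent_mono hu huv
  have := h.a_nonneg
  gcongr

lemma IsBranchingData.continuousAt_branchingSymbol (h : IsBranchingData a b n) {u : ℝ}
    (hu : 0 < u) : ContinuousAt (branchingSymbol a b n) u := by
  have := h.continuousAt_tailExponent hu
  have h2 : ContinuousAt (fun u => a * u + b + tailExponent n u) u := by fun_prop
  exact h2

/-- Finiteness of `Φ(1)` forces the branching symbol to be positive: being monotone, a zero of it
would make `1 / ψ` infinite on an interval. -/
lemma IsBranchingData.branchingSymbol_pos (h : IsBranchingData a b n)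
    (hΦ : laplaceExponent a b n 1 < ⊤) {u : ℝ} (hu : 0 < u) : 0 < branchingSymbol a b n u := by
  refine (h.branchingSymbol_nonneg hu.le).lt_of_ne' fun h0 => hΦ.ne ?_
  have hm : (0 : ℝ) < min u 1 := lt_min hu one_pos
  refine top_le_iff.1 ?_
  calc (⊤ : ℝ≥0∞) = ∫⁻ v in Ioc 0 (min u 1), ⊤ := by
        rw [setLIntegral_const, ENNReal.top_mul]
        simpa using hu
    _ ≤ ∫⁻ v in Ioc 0 (min u 1), (ENNReal.ofReal (branchingSymbol a b n v))⁻¹ := by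
        refine setLIntegral_mono' measurableSet_Ioc fun v hv => ?_
        have : branchingSymbol a b n v ≤ 0 :=
          h0 ▸ h.branchingSymbol_mono hv.1.le (hv.2.trans (min_le_left _ _))
        rw [ENNReal.ofReal_of_nonpos this, ENNReal.inv_zero]
    _ ≤ laplaceExponent a b n 1 :=
        lintegral_mono_set (Ioc_subset_Ioc_right (min_le_right _ _))

end

/-! ### The exponent `Φ` and size-biased Laplace transforms -/

section

variable {a b : ℝ} {n Λ : Measure ℝ}

/-- `∫ x e^{-sx} ρ(dx)`, the size-biased Laplace transform of `ρ`. -/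
noncomputable def sizeBiased (ρ : Measure ℝ) (s : ℝ) : ℝ :=
  ∫ x, x * Real.exp (-(s * x)) ∂ρ

lemma mul_exp_neg_le {s x : ℝ} (hs : 0 < s) : x * Real.exp (-(s * x)) ≤ 1 / s := by
  have h1 : s * x ≤ Real.exp (s * x) := by linarith [Real.add_one_le_exp (s * x)]
  rw [Real.exp_neg, le_div_iff₀ hs, ← div_eq_mul_inv, div_mul_eq_mul_div,
    div_le_one (Real.exp_pos _)]
  linarith

lemma IsLevyMeasure.integrable_min (h : IsLevyMeasure Λ) :
    Integrable (fun y : ℝ => min 1 y) Λ := by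
  refine (lintegral_ofReal_ne_top_iff_integrable (by fun_prop) ?_).1 h.lintegral_lt_top.ne
  filter_upwards [ae_pos_of_null h.null_nonpos] with y hy
  exact le_min zero_le_one hy.le

lemma IsLevyMeasure.integrable_one_sub_exp (h : IsLevyMeasure Λ) {l : ℝ} (hl : 0 ≤ l) :
    Integrable (fun y : ℝ => 1 - Real.exp (-(l * y))) Λ := by
  refine (h.integrable_min.const_mul (l + 1)).mono' (by fun_prop) ?_
  filter_upwards [ae_pos_of_null h.null_nonpos] with y hy
  rw [Real.norm_of_nonneg (one_sub_exp_nonneg hl hy.le)]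
  rcases le_total 1 y with h1 | h1
  · rw [min_eq_left h1]
    linarith [Real.exp_pos (-(l * y))]
  · rw [min_eq_right h1]
    linarith [Real.add_one_le_exp (-(l * y))]

lemma IsLevyMeasure.integrable_mul_exp (h : IsLevyMeasure Λ) {s : ℝ} (hs : 0 < s) :
    Integrable (fun y : ℝ => y * Real.exp (-(s * y))) Λ := by
  refine (h.integrable_min.const_mul (1 / s + 1)).mono' (by fun_prop) ?_
  filter_upwards [ae_pos_of_null h.null_nonpos] with y hy
  rw [Real.norm_of_nonneg (by positivity)]
  have h0 : 0 < 1 / s := by positivity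
  rcases le_total 1 y with h1 | h1
  · rw [min_eq_left h1]
    linarith [mul_exp_neg_le (x := y) hs]
  · rw [min_eq_right h1]
    have : Real.exp (-(s * y)) ≤ 1 := by
      rw [Real.exp_le_one_iff, neg_nonpos]
      positivity
    nlinarith [mul_pos h0 hy]

lemma IsLevyMeasure.hasDerivAt_integral (h : IsLevyMeasure Λ) {s : ℝ} (hs : 0 < s) :
    HasDerivAt (fun l => ∫ y, (1 - Real.exp (-(l * y))) ∂Λ) (sizeBiased Λ s) s := by
  refine (hasDerivAt_integral_of_dominated_loc_of_deriv_le
    (F := fun l y => 1 - Real.exp (-(l * y))) (F' := fun l y => y * Real.exp (-(l * y)))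
    (bound := fun y => y * Real.exp (-(s / 2 * y)))
    (Ioi_mem_nhds (half_lt_self hs)) (Eventually.of_forall fun v => by fun_prop)
    (h.integrable_one_sub_exp hs.le) (by fun_prop) ?_ (h.integrable_mul_exp (half_pos hs)) ?_).2
  · filter_upwards [ae_pos_of_null h.null_nonpos] with y hy l hl
    have : s / 2 ≤ l := le_of_lt hl
    rw [Real.norm_of_nonneg (by positivity)]
    gcongr
  · refine ae_of_all _ fun y l _ => ?_
    have h1 : HasDerivAt (fun l : ℝ => -(l * y)) (-(1 * y)) l :=
      ((hasDerivAt_id l).mul_const y).neg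
    refine (h1.exp.const_sub 1).congr_deriv ?_
    ring

lemma toReal_laplaceExponent_eq_levy (hΛ : IsLevyMeasure Λ)
    (hΦΛ : ∀ l : ℝ, 0 ≤ l →
      laplaceExponent a b n l = ∫⁻ y, ENNReal.ofReal (1 - Real.exp (-(l * y))) ∂Λ)
    {l : ℝ} (hl : 0 ≤ l) :
    (laplaceExponent a b n l).toReal = ∫ y, (1 - Real.exp (-(l * y))) ∂Λ := by
  rw [hΦΛ l hl, integral_eq_lintegral_of_nonneg_ae ?_ (by fun_prop)]
  filter_upwards [ae_pos_of_null hΛ.null_nonpos] with y hy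
  exact one_sub_exp_nonneg hl hy.le

lemma laplaceExponent_lt_top (hΛ : IsLevyMeasure Λ)
    (hΦΛ : ∀ l : ℝ, 0 ≤ l →
      laplaceExponent a b n l = ∫⁻ y, ENNReal.ofReal (1 - Real.exp (-(l * y))) ∂Λ)
    {l : ℝ} (hl : 0 ≤ l) : laplaceExponent a b n l < ⊤ := by
  rw [hΦΛ l hl, lt_top_iff_ne_top]
  refine (lintegral_ofReal_ne_top_iff_integrable (by fun_prop) ?_).2
    (hΛ.integrable_one_sub_exp hl)
  filter_upwards [ae_pos_of_null hΛ.null_nonpos] with y hy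
  exact one_sub_exp_nonneg hl hy.le

lemma IsBranchingData.continuousOn_inv (h : IsBranchingData a b n)
    (hΦ : laplaceExponent a b n 1 < ⊤) :
    ContinuousOn (fun u => (branchingSymbol a b n u)⁻¹) (Ioi 0) := fun _ hu =>
  ((h.continuousAt_branchingSymbol hu).inv₀
    (h.branchingSymbol_pos hΦ hu).ne').continuousWithinAt

lemma IsBranchingData.setLIntegral_inv (h : IsBranchingData a b n)
    (hΦ : laplaceExponent a b n 1 < ⊤) (l : ℝ) :
    ∫⁻ u in Ioc 0 l, ENNReal.ofReal (branchingSymbol a b n u)⁻¹ = laplaceExponent a b n l := by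
  refine setLIntegral_congr_fun measurableSet_Ioc fun u hu => ?_
  exact ENNReal.ofReal_inv_of_pos (h.branchingSymbol_pos hΦ hu.1)

/-- `Φ' = 1 / ψ` on `(0, ∞)`. -/
lemma IsBranchingData.hasDerivAt_laplaceExponent (h : IsBranchingData a b n)
    (hfin : ∀ l, 0 ≤ l → laplaceExponent a b n l < ⊤) {s : ℝ} (hs : 0 < s) :
    HasDerivAt (fun l => (laplaceExponent a b n l).toReal) (branchingSymbol a b n s)⁻¹ s := by
  have hΦ := hfin 1 zero_le_one
  have hco := h.continuousOn_inv hΦ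
  have hnn : ∀ l, 0 ≤ᵐ[volume.restrict (Ioc 0 l)] fun u => (branchingSymbol a b n u)⁻¹ :=
    fun l => (ae_restrict_iff' measurableSet_Ioc).2 (ae_of_all _ fun u hu =>
      inv_nonneg.2 (h.branchingSymbol_nonneg hu.1.le))
  have hsm : ∀ l, AEStronglyMeasurable (fun u => (branchingSymbol a b n u)⁻¹)
      (volume.restrict (Ioc 0 l)) :=
    fun l => (hco.mono Ioc_subset_Ioi_self).aestronglyMeasurable measurableSet_Ioc
  have heq : ∀ l, 0 ≤ l → (laplaceExponent a b n l).toReal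
      = ∫ u in (0 : ℝ)..l, (branchingSymbol a b n u)⁻¹ := by
    intro l hl
    rw [intervalIntegral.integral_of_le hl, integral_eq_lintegral_of_nonneg_ae (hnn l) (hsm l),
      h.setLIntegral_inv hΦ]
  have hint : IntervalIntegrable (fun u => (branchingSymbol a b n u)⁻¹) volume 0 s := by
    rw [intervalIntegrable_iff_integrableOn_Ioc_of_le hs.le]
    refine (lintegral_ofReal_ne_top_iff_integrable (hsm s) (hnn s)).1 ?_
    rw [h.setLIntegral_inv hΦ]
    exact (hfin s hs.le).ne
  have hd := intervalIntegral.integral_hasDerivAt_right hint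
    (hco.stronglyMeasurableAtFilter isOpen_Ioi s hs) (hco.continuousAt (Ioi_mem_nhds hs))
  refine hd.congr_of_eventuallyEq ?_
  filter_upwards [Ioi_mem_nhds hs] with l hl
  exact heq l (le_of_lt hl)

/-- The size-biased Laplace transform of `Λ` is `Φ' = 1 / ψ`. -/
lemma IsBranchingData.sizeBiased_levy (h : IsBranchingData a b n) (hΛ : IsLevyMeasure Λ)
    (hΦΛ : ∀ l : ℝ, 0 ≤ l →
      laplaceExponent a b n l = ∫⁻ y, ENNReal.ofReal (1 - Real.exp (-(l * y))) ∂Λ)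
    {s : ℝ} (hs : 0 < s) : sizeBiased Λ s = (branchingSymbol a b n s)⁻¹ := by
  refine (hΛ.hasDerivAt_integral hs).unique
    ((h.hasDerivAt_laplaceExponent (fun l => laplaceExponent_lt_top hΛ hΦΛ)
      hs).congr_of_eventuallyEq ?_)
  filter_upwards [Ioi_mem_nhds hs] with l hl
  exact (toReal_laplaceExponent_eq_levy hΛ hΦΛ (le_of_lt hl)).symm

lemma integral_toLine (μ : Measure ℝ≥0) (f : ℝ → ℝ) :
    ∫ x, f x ∂(toLine μ) = ∫ x : ℝ≥0, f x ∂μ :=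
  (MeasurableEmbedding.subtype_coe measurableSet_Ici).integral_map f

lemma integrable_toLine {μ : Measure ℝ≥0} {f : ℝ → ℝ} :
    Integrable f (toLine μ) ↔ Integrable (fun x : ℝ≥0 => f x) μ :=
  (MeasurableEmbedding.subtype_coe measurableSet_Ici).integrable_map_iff

lemma ae_nonneg_toLine (μ : Measure ℝ≥0) : ∀ᵐ x ∂(toLine μ), 0 ≤ x := by
  rw [toLine, ae_map_iff (by fun_prop) measurableSet_Ici]
  exact ae_of_all _ fun x => x.2

lemma integrable_exp_nnreal (μ : Measure ℝ≥0) [IsProbabilityMeasure μ] {s : ℝ} (hs : 0 ≤ s) :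
    Integrable (fun x : ℝ≥0 => Real.exp (-(s * x))) μ := by
  refine (integrable_const (1 : ℝ)).mono' (by fun_prop) (ae_of_all _ fun x => ?_)
  rw [Real.norm_of_nonneg (Real.exp_nonneg _), Real.exp_le_one_iff, neg_nonpos]
  positivity

lemma integrable_mul_exp_nnreal (μ : Measure ℝ≥0) [IsProbabilityMeasure μ] {s : ℝ} (hs : 0 < s) :
    Integrable (fun x : ℝ≥0 => (x : ℝ) * Real.exp (-(s * x))) μ := by
  refine (integrable_const (1 / s)).mono' (by fun_prop) (ae_of_all _ fun x => ?_)
  rw [Real.norm_of_nonneg (by positivity)]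
  exact mul_exp_neg_le hs

/-- Differentiating the Laplace transform of `ν_δ`. -/
lemma HasLaplaceExponent.sizeBiased_toLine {μ : Measure ℝ≥0} {φ : ℝ → ℝ} {φ' s : ℝ}
    (hμ : HasLaplaceExponent μ φ) (hs : 0 < s) (hφ : HasDerivAt φ φ' s) :
    sizeBiased (toLine μ) s = φ' * Real.exp (-φ s) := by
  have := hμ.1
  rw [sizeBiased, integral_toLine]
  have hsub : Iic (0 : ℝ) ⊆ integrableExpSet (fun x : ℝ≥0 => (x : ℝ)) μ := fun t ht => by
    have := integrable_exp_nnreal μ (neg_nonneg.2 ht)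
    simpa [integrableExpSet] using this
  have hmem : -s ∈ interior (integrableExpSet (fun x : ℝ≥0 => (x : ℝ)) μ) :=
    interior_mono hsub (by simpa using hs)
  have hd := (hasDerivAt_mgf hmem).scomp s (hasDerivAt_neg s)
  have hd2 : HasDerivAt (fun l => Real.exp (-φ l)) (Real.exp (-φ s) * -φ') s := hφ.neg.exp
  have he : (mgf (fun x : ℝ≥0 => (x : ℝ)) μ ∘ Neg.neg) =ᶠ[𝓝 s] fun l => Real.exp (-φ l) := by
    filter_upwards [Ioi_mem_nhds hs] with l hl
    rw [← hμ.2 l (le_of_lt hl)]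
    simp [mgf]
  have := hd.unique (hd2.congr_of_eventuallyEq he)
  simp only [neg_mul, smul_eq_mul, one_mul] at this
  linarith

end

/-! ### Finite sums of exponentials and their kernel forms -/

section

variable {a b : ℝ} {n Λ ρ : Measure ℝ} {ι κ : Type*} [Fintype ι] [Fintype κ]

/-- The function `x ↦ ∑ i, c i e^{-(l i) x}`. -/
noncomputable def expSum (c l : ι → ℝ) (x : ℝ) : ℝ :=
  ∑ i, c i * Real.exp (-(l i * x))

/-- The double sum `∑ i j, c i d j K(l i, m j)`: the value on `∑ c i e_{l i}` and `∑ d j e_{m j}`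
of the bilinear form with values `K(l, m)` on the exponentials `e_l`, `e_m`. -/
def kernelForm (K : ℝ → ℝ → ℝ) (c l : ι → ℝ) (d m : κ → ℝ) : ℝ :=
  ∑ i, ∑ j, c i * d j * K (l i) (m j)

lemma exists_expSum {f : ℝ → ℝ} (hf : f ∈ expSpan) :
    ∃ (k : ℕ) (c l : Fin k → ℝ), (∀ i, 0 ≤ l i) ∧ f = expSum c l := by
  obtain ⟨k, c, g, rfl⟩ := Submodule.mem_span_set'.1 hf
  choose l hl hg using fun i => (g i).2
  refine ⟨k, c, l, hl, ?_⟩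
  ext x
  simp only [Finset.sum_apply, Pi.smul_apply, smul_eq_mul, expSum]
  refine Finset.sum_congr rfl fun i _ => ?_
  rw [hg i]

lemma exp_mem_expSpan {l : ℝ} (hl : 0 ≤ l) : (fun x => Real.exp (-(l * x))) ∈ expSpan :=
  Submodule.subset_span ⟨l, hl, rfl⟩

lemma expSum_mem_expSpan {c l : ι → ℝ} (hl : ∀ i, 0 ≤ l i) : expSum c l ∈ expSpan := by
  have : expSum c l = ∑ i, c i • fun x => Real.exp (-(l i * x)) := by
    ext x
    simp [expSum]
  rw [this]
  exact Submodule.sum_mem _ fun i _ => Submodule.smul_mem _ _ (exp_mem_expSpan (hl i))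

lemma hasDerivAt_expSum (c l : ι → ℝ) (x : ℝ) :
    HasDerivAt (expSum c l) (expSum (fun i => -(c i * l i)) l x) x := by
  refine HasDerivAt.fun_sum fun i _ => ?_
  have h1 : HasDerivAt (fun x : ℝ => -(l i * x)) (-(l i * 1)) x :=
    ((hasDerivAt_id x).const_mul (l i)).neg
  refine (h1.exp.const_mul (c i)).congr_deriv ?_
  ring

lemma deriv_expSum (c l : ι → ℝ) :
    deriv (expSum c l) = expSum (fun i => -(c i * l i)) l :=
  funext fun x => (hasDerivAt_expSum c l x).deriv

lemma expSum_mul_expSum (c l : ι → ℝ) (d m : κ → ℝ) (x : ℝ) :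
    expSum c l x * expSum d m x
      = kernelForm (fun l m => Real.exp (-((l + m) * x))) c l d m := by
  rw [expSum, expSum, Finset.sum_mul_sum]
  refine Finset.sum_congr rfl fun i _ => Finset.sum_congr rfl fun j _ => ?_
  have : -((l i + m j) * x) = -(l i * x) + -(m j * x) := by ring
  beta_reduce
  rw [this, Real.exp_add]
  ring

lemma kernelForm_congr {K K' : ℝ → ℝ → ℝ} {c l : ι → ℝ} {d m : κ → ℝ}
    (hl : ∀ i, 0 ≤ l i) (hm : ∀ j, 0 ≤ m j) (h : ∀ u v, 0 ≤ u → 0 ≤ v → K u v = K' u v) :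
    kernelForm K c l d m = kernelForm K' c l d m := by
  refine Finset.sum_congr rfl fun i _ => Finset.sum_congr rfl fun j _ => ?_
  rw [h _ _ (hl i) (hm j)]

lemma mul_kernelForm (r : ℝ) (K : ℝ → ℝ → ℝ) (c l : ι → ℝ) (d m : κ → ℝ) :
    r * kernelForm K c l d m = kernelForm (fun u v => r * K u v) c l d m := by
  simp only [kernelForm, Finset.mul_sum]
  refine Finset.sum_congr rfl fun i _ => Finset.sum_congr rfl fun j _ => ?_
  ring

lemma kernelForm_add (K K' : ℝ → ℝ → ℝ) (c l : ι → ℝ) (d m : κ → ℝ) :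
    kernelForm K c l d m + kernelForm K' c l d m
      = kernelForm (fun u v => K u v + K' u v) c l d m := by
  simp only [kernelForm, ← Finset.sum_add_distrib, mul_add]

lemma kernelForm_swap (K : ℝ → ℝ → ℝ) (c l : ι → ℝ) (d m : κ → ℝ) :
    kernelForm K c l d m = kernelForm (fun u v => K v u) d m c l := by
  rw [kernelForm, Finset.sum_comm]
  refine Finset.sum_congr rfl fun i _ => Finset.sum_congr rfl fun j _ => ?_
  ring

section integral

variable {α : Type*} [MeasurableSpace α] {μ : Measure α} {F : ℝ → ℝ → α → ℝ}
  {c l : ι → ℝ} {d m : κ → ℝ}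

lemma integrable_kernelForm (hl : ∀ i, 0 ≤ l i) (hm : ∀ j, 0 ≤ m j)
    (hF : ∀ u v, 0 ≤ u → 0 ≤ v → Integrable (F u v) μ) :
    Integrable (fun y => kernelForm (fun u v => F u v y) c l d m) μ :=
  integrable_finsetSum _ fun i _ => integrable_finsetSum _ fun j _ =>
    (hF _ _ (hl i) (hm j)).const_mul _

lemma integral_kernelForm (hl : ∀ i, 0 ≤ l i) (hm : ∀ j, 0 ≤ m j)
    (hF : ∀ u v, 0 ≤ u → 0 ≤ v → Integrable (F u v) μ) :
    ∫ y, kernelForm (fun u v => F u v y) c l d m ∂μ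
      = kernelForm (fun u v => ∫ y, F u v y ∂μ) c l d m := by
  simp only [kernelForm]
  rw [integral_finsetSum _ fun i _ => integrable_finsetSum _ fun j _ =>
    (hF _ _ (hl i) (hm j)).const_mul _]
  refine Finset.sum_congr rfl fun i _ => ?_
  rw [integral_finsetSum _ fun j _ => (hF _ _ (hl i) (hm j)).const_mul _]
  simp_rw [integral_const_mul]

end integral

/-- The size-biased exponentials `x e^{-sx}` are integrable for `s > 0`. For `s = 0` this may
fail, and then `sizeBiased ρ 0` has the value `0`; the kernels below all vanish there. -/
def SizeBiasable (ρ : Measure ℝ) : Prop :=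
  ∀ s, 0 < s → Integrable (fun x => x * Real.exp (-(s * x))) ρ

lemma SizeBiasable.integrable_kernel (hρ : SizeBiasable ρ) {k : ℝ → ℝ → ℝ} (hk : k 0 0 = 0)
    (u v : ℝ) (hu : 0 ≤ u) (hv : 0 ≤ v) :
    Integrable (fun x => x * (k u v * Real.exp (-((u + v) * x)))) ρ := by
  rcases (add_nonneg hu hv).eq_or_lt with h0 | h0
  · obtain rfl : u = 0 := by linarith
    obtain rfl : v = 0 := by linarith
    simp [hk]
  · simp_rw [mul_left_comm _ (k u v)]
    exact (hρ _ h0).const_mul _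

lemma SizeBiasable.integral_kernelForm (hρ : SizeBiasable ρ) {k : ℝ → ℝ → ℝ} (hk : k 0 0 = 0)
    {c l : ι → ℝ} {d m : κ → ℝ} (hl : ∀ i, 0 ≤ l i) (hm : ∀ j, 0 ≤ m j) :
    ∫ x, x * kernelForm (fun u v => k u v * Real.exp (-((u + v) * x))) c l d m ∂ρ
      = kernelForm (fun u v => k u v * sizeBiased ρ (u + v)) c l d m := by
  simp_rw [mul_kernelForm]
  rw [CBCI.integral_kernelForm hl hm (hρ.integrable_kernel hk)]
  refine kernelForm_congr hl hm fun u v _ _ => ?_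
  simp_rw [mul_left_comm _ (k u v)]
  rw [integral_const_mul, sizeBiased]

lemma SizeBiasable.integrable_kernelForm (hρ : SizeBiasable ρ) {k : ℝ → ℝ → ℝ}
    (hk : k 0 0 = 0) {c l : ι → ℝ} {d m : κ → ℝ} (hl : ∀ i, 0 ≤ l i) (hm : ∀ j, 0 ≤ m j) :
    Integrable (fun x =>
      x * kernelForm (fun u v => k u v * Real.exp (-((u + v) * x))) c l d m) ρ := by
  simp_rw [mul_kernelForm]
  exact CBCI.integrable_kernelForm hl hm (hρ.integrable_kernel hk)

lemma IsLevyMeasure.sizeBiasable (hΛ : IsLevyMeasure Λ) : SizeBiasable Λ :=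
  fun _ hs => hΛ.integrable_mul_exp hs

lemma sizeBiasable_toLine (μ : Measure ℝ≥0) [IsProbabilityMeasure μ] :
    SizeBiasable (toLine μ) :=
  fun _ hs => integrable_toLine.2 (integrable_mul_exp_nnreal μ hs)

/-- The kernel of the form `B` on exponentials. -/
noncomputable def tailKernel (n : Measure ℝ) (u v : ℝ) : ℝ :=
  u * (tailExponent n (u + v) - tailExponent n u)

/-- The kernel `∫ (1 - e^{-uy}) (1 - e^{-vy}) n(dy)` of the jump energy on exponentials. -/
noncomputable def jumpKernel (n : Measure ℝ) (u v : ℝ) : ℝ :=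
  ∫ y, (1 - Real.exp (-(u * y))) * (1 - Real.exp (-(v * y))) ∂n

lemma tailKernel_zero : tailKernel n 0 0 = 0 := by simp [tailKernel]

lemma jumpKernel_zero : jumpKernel n 0 0 = 0 := by simp [jumpKernel]

lemma expSum_translate (c l : ι → ℝ) (x z : ℝ) :
    expSum c l (x + z) = expSum (fun i => c i * Real.exp (-(l i * z))) l x := by
  refine Finset.sum_congr rfl fun i _ => ?_
  have : -(l i * (x + z)) = -(l i * z) + -(l i * x) := by ring
  rw [this, Real.exp_add]
  ring

lemma expSum_sub (d m : ι → ℝ) (x y : ℝ) :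
    expSum d m (x + y) - expSum d m x
      = ∑ j, d j * Real.exp (-(m j * x)) * (Real.exp (-(m j * y)) - 1) := by
  rw [expSum_translate, expSum, expSum, ← Finset.sum_sub_distrib]
  refine Finset.sum_congr rfl fun j _ => ?_
  ring

lemma IsBranchingData.integral_tail_expSum (h : IsBranchingData a b n) {c l : ι → ℝ}
    {d m : κ → ℝ} (hl : ∀ i, 0 ≤ l i) (hm : ∀ j, 0 ≤ m j) (x : ℝ) :
    ∫ y, deriv (expSum c l) (x + y) * (expSum d m (x + y) - expSum d m x) ∂(tailMeasure n)
      = kernelForm (fun u v => tailKernel n u v * Real.exp (-((u + v) * x))) c l d m := by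
  have hpt : ∀ y, deriv (expSum c l) (x + y) * (expSum d m (x + y) - expSum d m x)
      = kernelForm (fun u v => u * Real.exp (-((u + v) * x))
        * (Real.exp (-(u * y)) * (1 - Real.exp (-(v * y))))) c l d m := by
    intro y
    rw [deriv_expSum, expSum_sub, expSum, Finset.sum_mul_sum]
    refine Finset.sum_congr rfl fun i _ => Finset.sum_congr rfl fun j _ => ?_
    have h1 : -(l i * (x + y)) = -(l i * x) + -(l i * y) := by ring
    have h2 : -((l i + m j) * x) = -(l i * x) + -(m j * x) := by ring
    beta_reduce
    rw [h1, h2, Real.exp_add, Real.exp_add]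
    ring
  simp_rw [hpt]
  rw [integral_kernelForm hl hm fun u v hu hv => (h.integrable_exp_mul_tail hu hv).const_mul _]
  refine kernelForm_congr hl hm fun u v hu hv => ?_
  rw [integral_const_mul, h.integral_exp_mul_tail hu hv, tailKernel]
  ring

/-- The form `B` on sums of exponentials. -/
lemma IsBranchingData.formB_expSum (h : IsBranchingData a b n) (hρ : SizeBiasable ρ)
    {c l : ι → ℝ} {d m : κ → ℝ} (hl : ∀ i, 0 ≤ l i) (hm : ∀ j, 0 ≤ m j) :
    formB n ρ (expSum c l) (expSum d m)
      = kernelForm (fun u v => tailKernel n u v * sizeBiased ρ (u + v)) c l d m := by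
  rw [formB]
  simp_rw [h.integral_tail_expSum hl hm]
  exact hρ.integral_kernelForm tailKernel_zero hl hm

lemma deriv_expSum_mul (c l : ι → ℝ) (d m : κ → ℝ) (x : ℝ) :
    deriv (expSum c l) x * deriv (expSum d m) x
      = kernelForm (fun u v => u * v * Real.exp (-((u + v) * x))) c l d m := by
  rw [deriv_expSum, deriv_expSum, expSum_mul_expSum]
  refine Finset.sum_congr rfl fun i _ => Finset.sum_congr rfl fun j _ => ?_
  ring

lemma integrable_deriv_mul (hρ : SizeBiasable ρ) {c l : ι → ℝ} {d m : κ → ℝ}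
    (hl : ∀ i, 0 ≤ l i) (hm : ∀ j, 0 ≤ m j) :
    Integrable (fun x => x * (deriv (expSum c l) x * deriv (expSum d m) x)) ρ := by
  simp_rw [deriv_expSum_mul]
  exact hρ.integrable_kernelForm (k := fun u v => u * v) (by simp) hl hm

lemma integral_deriv_mul (hρ : SizeBiasable ρ) {c l : ι → ℝ} {d m : κ → ℝ}
    (hl : ∀ i, 0 ≤ l i) (hm : ∀ j, 0 ≤ m j) :
    ∫ x, x * (deriv (expSum c l) x * deriv (expSum d m) x) ∂ρ
      = kernelForm (fun u v => u * v * sizeBiased ρ (u + v)) c l d m := by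
  simp_rw [deriv_expSum_mul]
  exact hρ.integral_kernelForm (k := fun u v => u * v) (by simp) hl hm

lemma gradientEnergy_expSum (hρ : SizeBiasable ρ) {c l : ι → ℝ} (hl : ∀ i, 0 ≤ l i) :
    gradientEnergy ρ (expSum c l)
      = kernelForm (fun u v => u * v * sizeBiased ρ (u + v)) c l c l := by
  rw [gradientEnergy]
  simp_rw [pow_two]
  exact integral_deriv_mul hρ hl hl

lemma IsBranchingData.jumpEnergy_expSum (h : IsBranchingData a b n) (hρ : SizeBiasable ρ)
    {d m : ι → ℝ} (hm : ∀ j, 0 ≤ m j) :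
    jumpEnergy n ρ (expSum d m)
      = kernelForm (fun u v => jumpKernel n u v * sizeBiased ρ (u + v)) d m d m := by
  rw [jumpEnergy]
  have hpt : ∀ x y, (expSum d m (x + y) - expSum d m x) ^ 2
      = kernelForm (fun u v => Real.exp (-((u + v) * x))
        * ((1 - Real.exp (-(u * y))) * (1 - Real.exp (-(v * y))))) d m d m := by
    intro x y
    rw [expSum_sub, pow_two, Finset.sum_mul_sum]
    refine Finset.sum_congr rfl fun i _ => Finset.sum_congr rfl fun j _ => ?_
    have h2 : -((m i + m j) * x) = -(m i * x) + -(m j * x) := by ring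
    beta_reduce
    rw [h2, Real.exp_add]
    ring
  have hin : ∀ x, ∫ y, (expSum d m (x + y) - expSum d m x) ^ 2 ∂n
      = kernelForm (fun u v => jumpKernel n u v * Real.exp (-((u + v) * x))) d m d m := by
    intro x
    simp_rw [hpt]
    rw [integral_kernelForm hm hm
      fun u v hu hv => (h.integrable_one_sub_exp_mul hu hv).const_mul _]
    refine kernelForm_congr hm hm fun u v hu hv => ?_
    rw [integral_const_mul, jumpKernel, mul_comm]
  simp_rw [hin]
  exact hρ.integral_kernelForm jumpKernel_zero hm hm

lemma gradientEnergy_nonneg (hρ : ∀ᵐ x ∂ρ, 0 ≤ x) (f : ℝ → ℝ) : 0 ≤ gradientEnergy ρ f := by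
  refine integral_nonneg_of_ae ?_
  filter_upwards [hρ] with x hx
  positivity

lemma jumpEnergy_nonneg (hρ : ∀ᵐ x ∂ρ, 0 ≤ x) (g : ℝ → ℝ) : 0 ≤ jumpEnergy n ρ g := by
  refine integral_nonneg_of_ae ?_
  filter_upwards [hρ] with x hx
  exact mul_nonneg hx (integral_nonneg fun y => sq_nonneg _)

end

/-! ### The bounds for `ν_δ` and for `Λ` -/

section

variable {a b C : ℝ} {n Λ ρ : Measure ℝ} {ι κ : Type*} [Fintype ι] [Fintype κ]

/-- The Cauchy–Schwarz inequality for a pointwise bounded form, by the discriminant of the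
nonnegative quadratic polynomial `t ↦ ∫ (G t² + 2 B t + J)`. -/
lemma sq_integral_le {α : Type*} [MeasurableSpace α] {μ : Measure α} {B G J : α → ℝ}
    (hB : Integrable B μ) (hG : Integrable G μ) (hJ : Integrable J μ)
    (hG0 : ∀ᵐ x ∂μ, 0 ≤ G x) (hJ0 : ∀ᵐ x ∂μ, 0 ≤ J x) (hle : ∀ᵐ x ∂μ, B x ^ 2 ≤ G x * J x) :
    (∫ x, B x ∂μ) ^ 2 ≤ (∫ x, G x ∂μ) * ∫ x, J x ∂μ := by
  have key : ∀ t : ℝ, 0 ≤ (∫ x, G x ∂μ) * (t * t) + (2 * ∫ x, B x ∂μ) * t + ∫ x, J x ∂μ := by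
    intro t
    have : (∫ x, G x ∂μ) * (t * t) + (2 * ∫ x, B x ∂μ) * t + ∫ x, J x ∂μ
        = ∫ x, (G x * (t * t) + B x * (2 * t) + J x) ∂μ := by
      have h1 : Integrable (fun x => G x * (t * t) + B x * (2 * t)) μ :=
        (hG.mul_const _).add (hB.mul_const _)
      rw [integral_add h1 hJ,
        integral_add (hG.mul_const _) (hB.mul_const _), integral_mul_const, integral_mul_const]
      ring
    rw [this]
    refine integral_nonneg_of_ae ?_
    filter_upwards [hG0, hJ0, hle] with x h1 h2 h3
    rcases h1.eq_or_lt with h0 | h0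
    · have : B x = 0 := by
        rw [← h0, zero_mul] at h3
        exact pow_eq_zero_iff two_ne_zero |>.1 (le_antisymm h3 (sq_nonneg _))
      simpa [← h0, this] using h2
    · refine nonneg_of_mul_nonneg_right (a := G x) ?_ h0
      nlinarith [sq_nonneg (G x * t + B x)]
  have := discrim_le_zero key
  rw [discrim] at this
  linarith

/-- `μ` has Laplace exponent `δ φ`, and its size-biased transform is that of `Λ` multiplied by
`δ e^{-δφ}`; this holds for `μ = ν_δ` and `φ = Φ`. -/
structure IsTilted (μ : Measure ℝ≥0) (Λ : Measure ℝ) (δ : ℝ) (φ : ℝ → ℝ) : Prop where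
  laplace : HasLaplaceExponent μ fun l => δ * φ l
  sizeBiased_eq : ∀ s, 0 < s →
    sizeBiased (toLine μ) s = δ * (sizeBiased Λ s * Real.exp (-(δ * φ s)))

lemma IsTilted.kernelForm_eq {μ : Measure ℝ≥0} {δ : ℝ} {φ : ℝ → ℝ} (h : IsTilted μ Λ δ φ)
    {k : ℝ → ℝ → ℝ} (hk : k 0 0 = 0) {c l : ι → ℝ} {d m : κ → ℝ}
    (hl : ∀ i, 0 ≤ l i) (hm : ∀ j, 0 ≤ m j) :
    kernelForm (fun u v => k u v * sizeBiased (toLine μ) (u + v)) c l d m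
      = δ * kernelForm (fun u v => k u v * sizeBiased Λ (u + v) * Real.exp (-(δ * φ (u + v))))
          c l d m := by
  rw [mul_kernelForm]
  refine kernelForm_congr hl hm fun u v hu hv => ?_
  rcases (add_nonneg hu hv).eq_or_lt with h0 | h0
  · obtain rfl : u = 0 := by linarith
    obtain rfl : v = 0 := by linarith
    simp [hk]
  · rw [h.sizeBiased_eq _ h0]
    ring

lemma tendsto_kernelForm (K : ℝ → ℝ → ℝ) (φ : ℝ → ℝ) (c l : ι → ℝ) (d m : κ → ℝ) :
    Tendsto (fun δ => kernelForm (fun u v => K u v * Real.exp (-(δ * φ (u + v)))) c l d m)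
      (𝓝[>] 0) (𝓝 (kernelForm K c l d m)) := by
  have hc : Continuous fun δ : ℝ =>
      kernelForm (fun u v => K u v * Real.exp (-(δ * φ (u + v)))) c l d m := by
    unfold kernelForm
    fun_prop
  have := hc.tendsto 0
  simp only [zero_mul, neg_zero, Real.exp_zero, mul_one] at this
  exact this.mono_left nhdsWithin_le_nhds

lemma kernelForm_translate (K : ℝ → ℝ → ℝ) (c l : ι → ℝ) (d m : κ → ℝ) (z : ℝ) :
    kernelForm K (fun i => c i * Real.exp (-(l i * z))) l
        (fun j => d j * Real.exp (-(m j * z))) m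
      = kernelForm (fun u v => K u v * Real.exp (-((u + v) * z))) c l d m := by
  refine Finset.sum_congr rfl fun i _ => Finset.sum_congr rfl fun j _ => ?_
  have : -((l i + m j) * z) = -(l i * z) + -(m j * z) := by ring
  beta_reduce
  rw [this, Real.exp_add]
  ring

lemma integrable_kernelForm_translate {μ : Measure ℝ≥0} [IsProbabilityMeasure μ]
    (K : ℝ → ℝ → ℝ) {c l : ι → ℝ} {d m : κ → ℝ} (hl : ∀ i, 0 ≤ l i) (hm : ∀ j, 0 ≤ m j) :
    Integrable (fun z : ℝ≥0 => kernelForm K (fun i => c i * Real.exp (-(l i * z))) l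
        (fun j => d j * Real.exp (-(m j * z))) m) μ := by
  simp_rw [kernelForm_translate]
  exact integrable_kernelForm hl hm fun u v hu hv =>
    (integrable_exp_nnreal μ (add_nonneg hu hv)).const_mul _

/-- Averaging a kernel form over translations by a `ν_δ`-distributed amount multiplies the kernel
by `e^{-δΦ(u + v)}`. -/
lemma HasLaplaceExponent.integral_kernelForm_translate {μ : Measure ℝ≥0} {φ : ℝ → ℝ}
    (hμ : HasLaplaceExponent μ φ) (K : ℝ → ℝ → ℝ) {c l : ι → ℝ} {d m : κ → ℝ}
    (hl : ∀ i, 0 ≤ l i) (hm : ∀ j, 0 ≤ m j) :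
    ∫ z : ℝ≥0, kernelForm K (fun i => c i * Real.exp (-(l i * z))) l
        (fun j => d j * Real.exp (-(m j * z))) m ∂μ
      = kernelForm (fun u v => K u v * Real.exp (-φ (u + v))) c l d m := by
  have := hμ.1
  simp_rw [kernelForm_translate]
  rw [integral_kernelForm hl hm fun u v hu hv =>
    (integrable_exp_nnreal μ (add_nonneg hu hv)).const_mul _]
  refine kernelForm_congr hl hm fun u v hu hv => ?_
  rw [integral_const_mul, hμ.2 _ (add_nonneg hu hv)]

lemma IsBranchingData.cauchySchwarzBound_iff (h : IsBranchingData a b n) (hρ : SizeBiasable ρ) :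
    CauchySchwarzBound n ρ C ↔ ∀ (k k' : ℕ) (c l : Fin k → ℝ) (d m : Fin k' → ℝ),
      (∀ i, 0 ≤ l i) → (∀ j, 0 ≤ m j) →
      kernelForm (fun u v => tailKernel n u v * sizeBiased ρ (u + v)) c l d m ^ 2
        ≤ C * kernelForm (fun u v => u * v * sizeBiased ρ (u + v)) c l c l
          * kernelForm (fun u v => jumpKernel n u v * sizeBiased ρ (u + v)) d m d m := by
  constructor
  · intro H k k' c l d m hl hm
    rw [← h.formB_expSum hρ hl hm, ← gradientEnergy_expSum hρ hl, ← h.jumpEnergy_expSum hρ hm]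
    exact H _ (expSum_mem_expSpan hl) _ (expSum_mem_expSpan hm)
  · intro H f hf g hg
    obtain ⟨k, c, l, hl, rfl⟩ := exists_expSum hf
    obtain ⟨k', d, m, hm, rfl⟩ := exists_expSum hg
    rw [h.formB_expSum hρ hl hm, gradientEnergy_expSum hρ hl, h.jumpEnergy_expSum hρ hm]
    exact H k k' c l d m hl hm

/-- The bound for `Λ` follows from the bounds for `ν_δ` as `δ → 0`, all three forms being
asymptotic to `δ` times the corresponding form for `Λ`. -/
lemma IsBranchingData.bound_levy (h : IsBranchingData a b n) (hΛ : IsLevyMeasure Λ)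
    {ν : ℝ → Measure ℝ≥0} {φ : ℝ → ℝ} (hν : ∀ δ, 0 < δ → IsTilted (ν δ) Λ δ φ)
    (H : ∀ δ, 0 < δ → CauchySchwarzBound n (toLine (ν δ)) C) : CauchySchwarzBound n Λ C := by
  rw [h.cauchySchwarzBound_iff hΛ.sizeBiasable]
  intro k k' c l d m hl hm
  refine le_of_tendsto_of_tendsto ((tendsto_kernelForm _ φ c l d m).pow 2)
    (((tendsto_kernelForm _ φ c l c l).const_mul C).mul (tendsto_kernelForm _ φ d m d m)) ?_
  filter_upwards [self_mem_nhdsWithin] with δ hδ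
  have hδ : 0 < δ := hδ
  have := (hν δ hδ).laplace.1
  have key := (h.cauchySchwarzBound_iff (sizeBiasable_toLine (ν δ))).1 (H δ hδ) k k' c l d m hl hm
  rw [(hν δ hδ).kernelForm_eq tailKernel_zero hl hm,
    (hν δ hδ).kernelForm_eq (k := fun u v => u * v) (by simp) hl hl,
    (hν δ hδ).kernelForm_eq jumpKernel_zero hm hm] at key
  refine le_of_mul_le_mul_left (a := δ ^ 2) ?_ (by positivity)
  linear_combination key

/-- The bound for `ν_δ` follows from the bound for `Λ`, applied to the translates `f (· + z)` and
`g (· + z)` and integrated over `z` with the Cauchy–Schwarz inequality. -/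
lemma IsBranchingData.bound_of_bound_levy (h : IsBranchingData a b n) (hΛ : IsLevyMeasure Λ)
    (hC : 0 ≤ C) {μ : Measure ℝ≥0} {δ : ℝ} {φ : ℝ → ℝ} (hμ : IsTilted μ Λ δ φ)
    (H : CauchySchwarzBound n Λ C) : CauchySchwarzBound n (toLine μ) C := by
  have := hμ.laplace.1
  have hpos : ∀ᵐ x ∂Λ, 0 ≤ x := (ae_pos_of_null hΛ.null_nonpos).mono fun x hx => hx.le
  rw [h.cauchySchwarzBound_iff (sizeBiasable_toLine μ)]
  intro k k' c l d m hl hm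
  rw [hμ.kernelForm_eq tailKernel_zero hl hm,
    hμ.kernelForm_eq (k := fun u v => u * v) (by simp) hl hl,
    hμ.kernelForm_eq jumpKernel_zero hm hm]
  rw [h.cauchySchwarzBound_iff hΛ.sizeBiasable] at H
  have key := sq_integral_le (μ := μ)
    (integrable_kernelForm_translate
      (fun u v => tailKernel n u v * sizeBiased Λ (u + v)) (c := c) (d := d) hl hm)
    ((integrable_kernelForm_translate
      (fun u v => u * v * sizeBiased Λ (u + v)) (c := c) (d := c) hl hl).const_mul C)
    (integrable_kernelForm_translate
      (fun u v => jumpKernel n u v * sizeBiased Λ (u + v)) (c := d) (d := d) hm hm)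
    (ae_of_all _ fun z => by
      rw [← gradientEnergy_expSum hΛ.sizeBiasable hl]
      exact mul_nonneg hC (gradientEnergy_nonneg hpos _))
    (ae_of_all _ fun z => by
      rw [← h.jumpEnergy_expSum hΛ.sizeBiasable hm]
      exact jumpEnergy_nonneg hpos _)
    (ae_of_all _ fun z => H k k' _ l _ m hl hm)
  rw [integral_const_mul, hμ.laplace.integral_kernelForm_translate _ hl hm,
    hμ.laplace.integral_kernelForm_translate _ hl hl,
    hμ.laplace.integral_kernelForm_translate _ hm hm] at key
  linear_combination δ ^ 2 * key

lemma IsBranchingData.isTilted (h : IsBranchingData a b n) (hΛ : IsLevyMeasure Λ)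
    (hΦΛ : ∀ l : ℝ, 0 ≤ l →
      laplaceExponent a b n l = ∫⁻ y, ENNReal.ofReal (1 - Real.exp (-(l * y))) ∂Λ)
    {μ : Measure ℝ≥0} {δ : ℝ}
    (hμ : HasLaplaceExponent μ fun l => δ * (laplaceExponent a b n l).toReal) :
    IsTilted μ Λ δ fun l => (laplaceExponent a b n l).toReal := by
  refine ⟨hμ, fun s hs => ?_⟩
  rw [hμ.sizeBiased_toLine hs ((h.hasDerivAt_laplaceExponent
    (fun l => laplaceExponent_lt_top hΛ hΦΛ) hs).const_mul δ), h.sizeBiased_levy hΛ hΦΛ hs]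
  ring

end

/-! ### The sector bound on sums of exponentials -/

section

variable {a b C δ : ℝ} {n Λ ρ : Measure ℝ} {ι κ : Type*} [Fintype ι] [Fintype κ]
  {P : ℝ≥0 → Kernel ℝ≥0 ℝ≥0} {μ : Measure ℝ≥0}

lemma IsBranchingData.integral_jump_expSum (h : IsBranchingData a b n) {c l : ι → ℝ}
    (hl : ∀ i, 0 ≤ l i) (x : ℝ) :
    ∫ y, (expSum c l (x + y) - expSum c l x - y * deriv (expSum c l) x) ∂n
      = ∑ i, c i * Real.exp (-(l i * x)) * (l i * tailExponent n (l i)) := by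
  have hpt : ∀ y, expSum c l (x + y) - expSum c l x - y * deriv (expSum c l) x
      = ∑ i, c i * Real.exp (-(l i * x)) * (Real.exp (-(l i * y)) - 1 + l i * y) := by
    intro y
    rw [expSum_sub, deriv_expSum, expSum, Finset.mul_sum, ← Finset.sum_sub_distrib]
    refine Finset.sum_congr rfl fun i _ => ?_
    ring
  simp_rw [hpt]
  rw [integral_finsetSum _ fun i _ => (h.integrable_compensated (hl i)).const_mul _]
  refine Finset.sum_congr rfl fun i _ => ?_
  rw [integral_const_mul, h.mul_tailExponent (hl i)]

/-- On exponentials, `L e_l = (x l ψ(l) - δ l) e_l`. -/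
lemma IsBranchingData.cbciOperator_expSum (h : IsBranchingData a b n) (δ : ℝ) {c l : ι → ℝ}
    (hl : ∀ i, 0 ≤ l i) (x : ℝ) :
    cbciOperator a b n δ (expSum c l) x
      = ∑ i, c i * ((x * (l i * branchingSymbol a b n (l i)) - δ * l i)
          * Real.exp (-(l i * x))) := by
  rw [cbciOperator, h.integral_jump_expSum hl, iteratedDeriv_succ, iteratedDeriv_one,
    deriv_expSum, deriv_expSum]
  simp only [expSum, Finset.mul_sum]
  rw [← Finset.sum_sub_distrib, ← Finset.sum_add_distrib, ← Finset.sum_add_distrib]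
  refine Finset.sum_congr rfl fun i _ => ?_
  rw [branchingSymbol_eq]
  ring

lemma IsBranchingData.tailKernel_symm (h : IsBranchingData a b n) {u v : ℝ} (hu : 0 ≤ u)
    (hv : 0 ≤ v) : tailKernel n u v + tailKernel n v u = jumpKernel n u v := by
  rw [jumpKernel, h.integral_one_sub_exp_mul hu hv, tailKernel, tailKernel, add_comm v u]
  ring

/-- The symmetric part of `B` is half of the jump energy. -/
lemma IsBranchingData.two_mul_formB (h : IsBranchingData a b n) (hρ : SizeBiasable ρ)
    {f : ℝ → ℝ} (hf : f ∈ expSpan) : 2 * formB n ρ f f = jumpEnergy n ρ f := by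
  obtain ⟨k, c, l, hl, rfl⟩ := exists_expSum hf
  rw [h.formB_expSum hρ hl hl, h.jumpEnergy_expSum hρ hl, two_mul]
  nth_rw 2 [kernelForm_swap]
  rw [kernelForm_add]
  refine kernelForm_congr hl hl fun u v hu hv => ?_
  rw [← h.tailKernel_symm hu hv, add_comm v u]
  ring

lemma sq_integral_deriv_mul_le (hρ : SizeBiasable ρ) (hpos : ∀ᵐ x ∂ρ, 0 ≤ x) {f g : ℝ → ℝ}
    (hf : f ∈ expSpan) (hg : g ∈ expSpan) :
    (∫ x, x * (deriv f x * deriv g x) ∂ρ) ^ 2 ≤ gradientEnergy ρ f * gradientEnergy ρ g := by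
  obtain ⟨k, c, l, hl, rfl⟩ := exists_expSum hf
  obtain ⟨k', d, m, hm, rfl⟩ := exists_expSum hg
  simp only [gradientEnergy, pow_two (deriv _ _)]
  refine sq_integral_le (integrable_deriv_mul hρ hl hm) (integrable_deriv_mul hρ hl hl)
    (integrable_deriv_mul hρ hm hm) ?_ ?_ (ae_of_all _ fun x => le_of_eq (by ring))
  · filter_upwards [hpos] with x hx
    exact mul_nonneg hx (mul_self_nonneg _)
  · filter_upwards [hpos] with x hx
    exact mul_nonneg hx (mul_self_nonneg _)

lemma integrable_affine_mul_exp [IsProbabilityMeasure μ] {r q s : ℝ} (hs : 0 < s) :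
    Integrable (fun x : ℝ≥0 => ((x : ℝ) * r - q) * Real.exp (-(s * x))) μ := by
  have h1 := (integrable_mul_exp_nnreal μ hs).const_mul r
  have h2 := (integrable_exp_nnreal μ hs.le).const_mul q
  refine (h1.sub h2).congr (ae_of_all _ fun x => ?_)
  simp only [Pi.sub_apply]
  ring

lemma integral_affine_mul_exp [IsProbabilityMeasure μ] {r q s : ℝ} (hs : 0 < s) :
    ∫ x : ℝ≥0, ((x : ℝ) * r - q) * Real.exp (-(s * x)) ∂μ
      = r * sizeBiased (toLine μ) s - q * ∫ x : ℝ≥0, Real.exp (-(s * x)) ∂μ := by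
  rw [sizeBiased, integral_toLine, ← integral_const_mul, ← integral_const_mul,
    ← integral_sub ((integrable_mul_exp_nnreal μ hs).const_mul r)
      ((integrable_exp_nnreal μ hs.le).const_mul q)]
  refine integral_congr_ae (ae_of_all _ fun x => ?_)
  ring

/-- On sums of exponentials `ℰ(f, g) = a ⟨x f' g'⟩ + B(f, g)`. -/
lemma IsBranchingData.energyForm_eq (h : IsBranchingData a b n) {φ : ℝ → ℝ}
    (hμ : HasLaplaceExponent μ φ)
    (hs : ∀ s, 0 < s → sizeBiased (toLine μ) s * branchingSymbol a b n s
      = δ * Real.exp (-φ s))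
    (hP : IsCBCITransition a b n δ P) {f g : ℝ → ℝ} (hf : f ∈ expSpan) (hg : g ∈ expSpan) :
    energyForm P μ (fun x => f x) (fun x => g x)
      = a * (∫ x, x * (deriv f x * deriv g x) ∂(toLine μ)) + formB n (toLine μ) f g := by
  have := hμ.1
  have hρ := sizeBiasable_toLine μ
  simp only [energyForm, hP.generator_eq f hf]
  obtain ⟨k, c, l, hl, rfl⟩ := exists_expSum hf
  obtain ⟨k', d, m, hm, rfl⟩ := exists_expSum hg
  rw [integral_deriv_mul hρ hl hm, h.formB_expSum hρ hl hm, mul_kernelForm, kernelForm_add]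
  have hpt : ∀ x : ℝ≥0, cbciOperator a b n δ (expSum c l) x * expSum d m x
      = kernelForm (fun u v => ((x : ℝ) * (u * branchingSymbol a b n u) - δ * u)
        * Real.exp (-((u + v) * x))) c l d m := by
    intro x
    rw [h.cbciOperator_expSum δ hl, expSum, Finset.sum_mul_sum]
    refine Finset.sum_congr rfl fun i _ => Finset.sum_congr rfl fun j _ => ?_
    have : -((l i + m j) * (x : ℝ)) = -(l i * x) + -(m j * x) := by ring
    beta_reduce
    rw [this, Real.exp_add]
    ring
  simp_rw [hpt]
  rw [integral_kernelForm hl hm fun u v hu hv => ?_, ← neg_one_mul, mul_kernelForm]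
  · refine kernelForm_congr hl hm fun u v hu hv => ?_
    rcases hu.eq_or_lt with rfl | hu0
    · simp [tailKernel]
    have hs0 : 0 < u + v := by linarith
    rw [integral_affine_mul_exp hs0, hμ.2 _ hs0.le, tailKernel]
    have key := hs _ hs0
    rw [branchingSymbol_eq] at key
    rw [branchingSymbol_eq]
    linear_combination -u * key
  · rcases hu.eq_or_lt with rfl | hu0
    · simp
    · exact integrable_affine_mul_exp (by linarith)

lemma sector_inequality {a C A A' J J' D B : ℝ} (ha : 0 < a) (hC : 0 < C) (hA : 0 ≤ A)
    (hA' : 0 ≤ A') (hJ : 0 ≤ J) (hJ' : 0 ≤ J') (hD : D ^ 2 ≤ A * A')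
    (hB : B ^ 2 ≤ C * A * J') :
    a * D + B ≤ (1 + √(2 * C / a)) * √(a * A + J / 2) * √(a * A' + J' / 2) := by
  set E := a * A + J / 2 with hE
  set E' := a * A' + J' / 2 with hE'
  have hE0 : 0 ≤ E := by positivity
  have hE0' : 0 ≤ E' := by positivity
  have h1 : a * D ≤ √(E * E') := by
    refine Real.le_sqrt_of_sq_le ?_
    calc (a * D) ^ 2 = a ^ 2 * D ^ 2 := by ring
      _ ≤ a ^ 2 * (A * A') := by gcongr
      _ = (a * A) * (a * A') := by ring
      _ ≤ E * E' := by
        refine mul_le_mul ?_ ?_ (by positivity) hE0 <;> linarith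
  have h2 : B ≤ √(2 * C / a * (E * E')) := by
    refine Real.le_sqrt_of_sq_le (hB.trans ?_)
    calc C * A * J' = 2 * C / a * ((a * A) * (J' / 2)) := by field_simp
      _ ≤ 2 * C / a * (E * E') := by
        refine mul_le_mul_of_nonneg_left ?_ (by positivity)
        refine mul_le_mul ?_ ?_ (by positivity) hE0
        · linarith
        · linarith [mul_nonneg ha.le hA']
  rw [Real.sqrt_mul (by positivity)] at h2
  rw [mul_assoc, ← Real.sqrt_mul hE0]
  linarith

/-- The sector inequality on sums of exponentials: `ℰ(f, f)` dominates both `a ⟨x f'²⟩` and half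
of the jump energy. -/
lemma IsBranchingData.energyForm_le (h : IsBranchingData a b n) {φ : ℝ → ℝ}
    (hμ : HasLaplaceExponent μ φ)
    (hs : ∀ s, 0 < s → sizeBiased (toLine μ) s * branchingSymbol a b n s
      = δ * Real.exp (-φ s))
    (hP : IsCBCITransition a b n δ P) (ha : 0 < a) (hC : 0 < C)
    (H : CauchySchwarzBound n (toLine μ) C) {f g : ℝ → ℝ} (hf : f ∈ expSpan)
    (hg : g ∈ expSpan) :
    energyForm P μ (fun x => f x) (fun x => g x)
      ≤ (1 + √(2 * C / a)) * √(energyForm P μ (fun x => f x) (fun x => f x))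
        * √(energyForm P μ (fun x => g x) (fun x => g x)) := by
  have := hμ.1
  have hρ := sizeBiasable_toLine μ
  have hpos := ae_nonneg_toLine μ
  have hdiag : ∀ f ∈ expSpan, energyForm P μ (fun x => f x) (fun x => f x)
      = a * gradientEnergy (toLine μ) f + jumpEnergy n (toLine μ) f / 2 := by
    intro f hf
    rw [h.energyForm_eq hμ hs hP hf hf, ← h.two_mul_formB hρ hf]
    simp only [gradientEnergy, pow_two]
    ring
  rw [hdiag f hf, hdiag g hg, h.energyForm_eq hμ hs hP hf hg]
  exact sector_inequality ha hC (gradientEnergy_nonneg hpos f) (gradientEnergy_nonneg hpos g)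
    (jumpEnergy_nonneg hpos f) (jumpEnergy_nonneg hpos g)
    (sq_integral_deriv_mul_le hρ hpos hf hg) (H f hf g hg)

end

/-! ### Density of the range of `1 - L` on sums of exponentials -/

section

open BoundedContinuousFunction

lemma exp_neg_max_mul_le_one (u : ℝ) (x : ℝ≥0) : ‖Real.exp (-(max u 0 * x))‖ ≤ 1 := by
  rw [Real.norm_of_nonneg (Real.exp_nonneg _), Real.exp_le_one_iff, neg_nonpos]
  positivity

/-- The bounded function `x ↦ e^{-ux}` on `[0, ∞)`, for `u ≥ 0`; negative `u` are replaced
by `0`. -/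
noncomputable def expFun (u : ℝ) : ℝ≥0 →ᵇ ℝ :=
  ofNormedAddCommGroup (fun x : ℝ≥0 => Real.exp (-(max u 0 * x))) (by fun_prop) 1
    (exp_neg_max_mul_le_one u)

lemma norm_mul_exp_neg_le {u : ℝ} (hu : 0 < u) (x : ℝ≥0) :
    ‖(x : ℝ) * Real.exp (-(u * x))‖ ≤ 1 / u := by
  rw [Real.norm_of_nonneg (by positivity)]
  exact mul_exp_neg_le hu

/-- The bounded function `x ↦ x e^{-ux}` on `[0, ∞)`, for `u > 0`; it is set to `0` for other
values of `u`. -/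
noncomputable def mulExpFun (u : ℝ) : ℝ≥0 →ᵇ ℝ :=
  if hu : 0 < u then
    ofNormedAddCommGroup (fun x : ℝ≥0 => (x : ℝ) * Real.exp (-(u * x))) (by fun_prop) (1 / u)
      (norm_mul_exp_neg_le hu)
  else 0

lemma expFun_apply {u : ℝ} (hu : 0 ≤ u) (x : ℝ≥0) : expFun u x = Real.exp (-(u * x)) := by
  change Real.exp (-(max u 0 * x)) = _
  rw [max_eq_left hu]

lemma mulExpFun_apply {u : ℝ} (hu : 0 < u) (x : ℝ≥0) :
    mulExpFun u x = x * Real.exp (-(u * x)) := by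
  rw [mulExpFun, dif_pos hu]
  rfl

lemma norm_expFun_le (u : ℝ) : ‖expFun u‖ ≤ 1 :=
  norm_ofNormedAddCommGroup_le _ zero_le_one _

lemma compensated_le_sq_mul_exp (w : ℝ) :
    Real.exp (-w) - 1 + w ≤ w ^ 2 * max 1 (Real.exp (-w)) := by
  rcases le_total 0 w with hw | hw
  · exact (compensated_le_sq hw).trans (le_mul_of_one_le_right (sq_nonneg w) (le_max_left _ _))
  · refine le_trans ?_ (mul_le_mul_of_nonneg_left (le_max_right _ _) (sq_nonneg w))
    have h1 : Real.exp w * Real.exp (-w) = 1 := by rw [← Real.exp_add]; simp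
    have h2 : 1 - w ^ 2 ≤ (1 - w) * Real.exp w := by
      nlinarith [Real.add_one_le_exp w]
    have h3 := mul_le_mul_of_nonneg_right h2 (Real.exp_nonneg (-w))
    rw [mul_assoc, h1] at h3
    linarith

/-- A second order Taylor estimate for `u ↦ e^{-ux}` that is uniform in `x`. -/
lemma exp_taylor_le {u v x : ℝ} (hu : 0 < u) (hv : u / 2 ≤ v) (hx : 0 ≤ x) :
    |Real.exp (-(v * x)) - Real.exp (-(u * x)) + (v - u) * (x * Real.exp (-(u * x)))|
      ≤ 16 / u ^ 2 * (v - u) ^ 2 := by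
  have hsplit : Real.exp (-(v * x)) = Real.exp (-(u * x)) * Real.exp (-((v - u) * x)) := by
    rw [← Real.exp_add]
    ring_nf
  have heq : Real.exp (-(v * x)) - Real.exp (-(u * x)) + (v - u) * (x * Real.exp (-(u * x)))
      = Real.exp (-(u * x)) * (Real.exp (-((v - u) * x)) - 1 + (v - u) * x) := by
    rw [hsplit]
    ring
  rw [heq, abs_of_nonneg (mul_nonneg (Real.exp_nonneg _) (compensated_nonneg _))]
  -- `e^{-ux}` and `e^{-vx}` are both at most `(e^{-ux/4})²`, which absorbs the factor `x²`
  have hmax : Real.exp (-(u * x)) * max 1 (Real.exp (-((v - u) * x)))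
      ≤ Real.exp (-(u / 4 * x)) ^ 2 := by
    rw [mul_max_of_nonneg _ _ (Real.exp_nonneg _), mul_one, ← hsplit, ← Real.exp_nat_mul]
    refine max_le (Real.exp_le_exp.2 ?_) (Real.exp_le_exp.2 ?_)
    · push_cast
      nlinarith [mul_nonneg hu.le hx]
    · push_cast
      nlinarith [mul_le_mul_of_nonneg_right hv hx]
  have hsq : (x * Real.exp (-(u / 4 * x))) ^ 2 ≤ (1 / (u / 4)) ^ 2 :=
    pow_le_pow_left₀ (by positivity) (mul_exp_neg_le (by positivity)) 2
  calc Real.exp (-(u * x)) * (Real.exp (-((v - u) * x)) - 1 + (v - u) * x)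
      ≤ Real.exp (-(u * x)) * (((v - u) * x) ^ 2 * max 1 (Real.exp (-((v - u) * x)))) :=
        mul_le_mul_of_nonneg_left (compensated_le_sq_mul_exp _) (Real.exp_nonneg _)
    _ = ((v - u) * x) ^ 2
        * (Real.exp (-(u * x)) * max 1 (Real.exp (-((v - u) * x)))) := by ring
    _ ≤ ((v - u) * x) ^ 2 * Real.exp (-(u / 4 * x)) ^ 2 := by gcongr
    _ = (v - u) ^ 2 * (x * Real.exp (-(u / 4 * x))) ^ 2 := by ring
    _ ≤ (v - u) ^ 2 * (1 / (u / 4)) ^ 2 := by gcongr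
    _ = 16 / u ^ 2 * (v - u) ^ 2 := by
        field_simp
        norm_num

lemma hasDerivAt_expFun {u : ℝ} (hu : 0 < u) : HasDerivAt expFun (-mulExpFun u) u := by
  rw [hasDerivAt_iff_isLittleO]
  refine Asymptotics.IsBigO.trans_isLittleO ?_
    (Asymptotics.isLittleO_pow_sub_sub u one_lt_two)
  refine Asymptotics.IsBigO.of_bound (16 / u ^ 2) ?_
  filter_upwards [Ioi_mem_nhds (half_lt_self hu)] with v hv
  have hv0 : 0 ≤ v := (half_pos hu).le.trans (le_of_lt hv)
  rw [norm_pow, norm_norm, Real.norm_eq_abs, sq_abs, norm_le (by positivity)]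
  intro x
  simp only [coe_sub, coe_smul, coe_neg, Pi.sub_apply, Pi.neg_apply, smul_eq_mul,
    expFun_apply hv0, expFun_apply hu.le, mulExpFun_apply hu, mul_neg, sub_neg_eq_add,
    Real.norm_eq_abs]
  exact exp_taylor_le hu (le_of_lt hv) x.2

/-- The bounded function `(1 - L) e_u` on `[0, ∞)`, where
`L e_u = (x u ψ(u) - δ u) e_u`. -/
noncomputable def resolventExp (ψ : ℝ → ℝ) (δ u : ℝ) : ℝ≥0 →ᵇ ℝ :=
  (1 + δ * u) • expFun u - (u * ψ u) • mulExpFun u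

lemma resolventExp_apply (ψ : ℝ → ℝ) (δ : ℝ) {u : ℝ} (hu : 0 ≤ u) (x : ℝ≥0) :
    resolventExp ψ δ u x
      = Real.exp (-(u * x)) - ((x : ℝ) * (u * ψ u) - δ * u) * Real.exp (-(u * x)) := by
  rcases hu.eq_or_lt with rfl | hu0
  · simp [resolventExp, expFun_apply]
  · simp only [resolventExp, coe_sub, coe_smul, Pi.sub_apply, smul_eq_mul, expFun_apply hu,
      mulExpFun_apply hu0]
    ring

/-- The closure of the range of `1 - L` on sums of exponentials. -/
noncomputable def resolventClosure (ψ : ℝ → ℝ) (δ : ℝ) : Submodule ℝ (ℝ≥0 →ᵇ ℝ) :=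
  (Submodule.span ℝ {F | ∃ u : ℝ, 0 ≤ u ∧ F = resolventExp ψ δ u}).topologicalClosure

lemma resolventExp_mem (ψ : ℝ → ℝ) (δ : ℝ) {u : ℝ} (hu : 0 ≤ u) :
    resolventExp ψ δ u ∈ resolventClosure ψ δ :=
  Submodule.le_topologicalClosure _ (Submodule.subset_span ⟨u, hu, rfl⟩)

lemma eq_zero_on_submodule {E : Type*} [AddCommGroup E] [Module ℝ E] (S : Submodule ℝ E)
    (ℓ : E →ₗ[ℝ] ℝ) {r : ℝ} (h : ∀ F ∈ S, ℓ F < r) : ∀ F ∈ S, ℓ F = 0 := by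
  intro F hF
  by_contra h0
  have := h ((r / ℓ F) • F) (S.smul_mem _ hF)
  rw [map_smul, smul_eq_mul, div_mul_cancel₀ _ h0] at this
  exact lt_irrefl _ this

/-- The primitive, normalised at `1`, of `(1 + δ u) / (u ψ(u))`; its exponential is an integrating
factor. -/
noncomputable def logFactor (ψ : ℝ → ℝ) (δ u : ℝ) : ℝ :=
  ∫ v in (1 : ℝ)..u, (1 + δ * v) / (v * ψ v)

variable {ψ : ℝ → ℝ} {δ : ℝ}

lemma hasDerivAt_logFactor (hcont : ∀ u, 0 < u → ContinuousAt ψ u)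
    (hpos : ∀ u, 0 < u → 0 < ψ u) {u : ℝ} (hu : 0 < u) :
    HasDerivAt (logFactor ψ δ) ((1 + δ * u) / (u * ψ u)) u := by
  have hc : ContinuousOn (fun v => (1 + δ * v) / (v * ψ v)) (Ioi 0) := by
    intro v hv
    have hv : 0 < v := hv
    have := hcont v hv
    have hne : v * ψ v ≠ 0 := (mul_pos hv (hpos v hv)).ne'
    have : ContinuousAt (fun v => (1 + δ * v) / (v * ψ v)) v := by fun_prop (disch := exact hne)
    exact this.continuousWithinAt
  refine intervalIntegral.integral_hasDerivAt_right ?_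
    (hc.stronglyMeasurableAtFilter isOpen_Ioi u hu) (hc.continuousAt (Ioi_mem_nhds hu))
  refine (hc.mono fun v hv => ?_).intervalIntegrable
  exact lt_of_lt_of_le (lt_min one_pos hu) hv.1

/-- Since `ψ ≤ ψ(1)` on `(0, 1]`, the integral of `1 / (u ψ(u))` diverges at `0`. -/
lemma logFactor_le (hcont : ∀ u, 0 < u → ContinuousAt ψ u) (hpos : ∀ u, 0 < u → 0 < ψ u)
    (hmono : ∀ u v, 0 < u → u ≤ v → ψ u ≤ ψ v) (hδ : 0 ≤ δ) {u : ℝ} (hu : 0 < u) (hu1 : u ≤ 1) :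
    logFactor ψ δ u ≤ Real.log u / ψ 1 := by
  have hd : ∀ v, 0 < v → HasDerivAt (fun v => logFactor ψ δ v - Real.log v / ψ 1)
      ((1 + δ * v) / (v * ψ v) - v⁻¹ / ψ 1) v := fun v hv =>
    (hasDerivAt_logFactor hcont hpos hv).sub ((Real.hasDerivAt_log hv.ne').div_const _)
  have hm : MonotoneOn (fun v => logFactor ψ δ v - Real.log v / ψ 1) (Ioc 0 1) := by
    refine monotoneOn_of_deriv_nonneg (convex_Ioc 0 1)
      (fun v hv => (hd v hv.1).continuousAt.continuousWithinAt) ?_ ?_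
    · rw [interior_Ioc]
      exact fun v hv => (hd v hv.1).differentiableAt.differentiableWithinAt
    · rw [interior_Ioc]
      intro v hv
      have hv0 : 0 < v := hv.1
      have h1 := hpos v hv0
      have h2 := hmono v 1 hv0 hv.2.le
      rw [(hd v hv0).deriv, sub_nonneg, inv_eq_one_div, div_div]
      gcongr
      linarith [mul_nonneg hδ hv0.le]
  have := hm ⟨hu, hu1⟩ ⟨one_pos, le_rfl⟩ hu1
  simp only [logFactor, intervalIntegral.integral_same, Real.log_one, zero_div, sub_zero] at this
  rw [logFactor]
  linarith

/-- Every exponential is a limit of elements `(1 - L) f`. With the integrating factor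
`V = exp (logFactor ψ δ)` one has `d/du (V e_u) = V / (u ψ(u)) (1 - L) e_u`, so that a functional
vanishing on the range of `1 - L` is constant along `V e_u`, which tends to `0` as `u → 0`. -/
lemma expFun_mem_resolventClosure (hcont : ∀ u, 0 < u → ContinuousAt ψ u)
    (hpos : ∀ u, 0 < u → 0 < ψ u) (hmono : ∀ u v, 0 < u → u ≤ v → ψ u ≤ ψ v) (hδ : 0 ≤ δ)
    {u : ℝ} (hu : 0 ≤ u) : expFun u ∈ resolventClosure ψ δ := by
  rcases hu.eq_or_lt with rfl | hu0
  · have := resolventExp_mem ψ δ (le_refl 0)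
    simpa [resolventExp] using this
  by_contra hmem
  obtain ⟨ℓ, r, hlt, hr⟩ := geometric_hahn_banach_closed_point
    (resolventClosure ψ δ).convex (Submodule.isClosed_topologicalClosure _) hmem
  have hz : ∀ F ∈ resolventClosure ψ δ, ℓ F = 0 :=
    eq_zero_on_submodule (resolventClosure ψ δ) ℓ.toLinearMap hlt
  have hr0 : 0 < r := by
    have := hlt 0 (zero_mem (resolventClosure ψ δ))
    rwa [map_zero] at this
  have hd : ∀ v, 0 < v → HasDerivAt
      (fun v => Real.exp (logFactor ψ δ v) * ℓ (expFun v)) 0 v := by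
    intro v hv
    have h1 := (hasDerivAt_logFactor (δ := δ) hcont hpos hv).exp
    have h2 : HasDerivAt (fun v => ℓ (expFun v)) (ℓ (-mulExpFun v)) v :=
      ℓ.hasFDerivAt.comp_hasDerivAt v (hasDerivAt_expFun hv)
    refine (h1.mul h2).congr_deriv ?_
    have h3 := hz _ (resolventExp_mem ψ δ hv.le)
    rw [resolventExp, map_sub, map_smul, map_smul, smul_eq_mul, smul_eq_mul] at h3
    have h4 : 0 < v * ψ v := mul_pos hv (hpos v hv)
    have h5 : ℓ (mulExpFun v) = (1 + δ * v) / (v * ψ v) * ℓ (expFun v) := by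
      rw [div_mul_eq_mul_div, eq_div_iff h4.ne']
      linear_combination -h3
    rw [map_neg, h5]
    ring
  have hconst : ∀ v, 0 < v → Real.exp (logFactor ψ δ v) * ℓ (expFun v)
      = Real.exp (logFactor ψ δ u) * ℓ (expFun u) := fun v hv =>
    isOpen_Ioi.is_const_of_deriv_eq_zero isPreconnected_Ioi
      (fun w hw => (hd w hw).differentiableAt.differentiableWithinAt)
      (fun w hw => (hd w hw).deriv) (mem_Ioi.2 hv) (mem_Ioi.2 hu0)
  have hlim : Tendsto (fun v => Real.exp (Real.log v / ψ 1) * ‖ℓ‖) (𝓝[>] 0) (𝓝 0) := by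
    have h1 := (Real.tendsto_log_nhdsGT_zero).atBot_div_const (hpos 1 one_pos)
    simpa using (Real.tendsto_exp_atBot.comp h1).mul_const ‖ℓ‖
  have hle : Real.exp (logFactor ψ δ u) * ℓ (expFun u) ≤ 0 := by
    refine ge_of_tendsto hlim ?_
    filter_upwards [Ioc_mem_nhdsGT (zero_lt_one' ℝ)] with v hv
    rw [← hconst v hv.1]
    have h1 : ℓ (expFun v) ≤ ‖ℓ‖ :=
      (le_abs_self _).trans ((ℓ.le_opNorm _).trans
        (mul_le_of_le_one_right (norm_nonneg _) (norm_expFun_le v)))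
    have h2 := logFactor_le hcont hpos hmono hδ hv.1 hv.2
    calc Real.exp (logFactor ψ δ v) * ℓ (expFun v)
        ≤ Real.exp (logFactor ψ δ v) * ‖ℓ‖ := by gcongr
      _ ≤ Real.exp (Real.log v / ψ 1) * ‖ℓ‖ := by gcongr
  have := mul_pos (Real.exp_pos (logFactor ψ δ u)) (hr0.trans hr)
  linarith

/-- Weierstrass approximation on `[0, 1]` in the variable `t = e^{-x}`. -/
lemma IsContExt.exists_polynomial_near {f : ℝ≥0 → ℝ} (hf : IsContExt f) {ε : ℝ} (hε : 0 < ε) :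
    ∃ p : Polynomial ℝ, ∀ x : ℝ≥0, |p.eval (Real.exp (-x)) - f x| < ε := by
  obtain ⟨hc, L, hL⟩ := hf
  let g : ℝ → ℝ := Function.update (fun t => f (-Real.log t).toNNReal) 0 L
  have hg : ContinuousOn g (Icc 0 1) := by
    rw [continuousOn_update_iff]
    constructor
    · have hlog : ContinuousOn Real.log (Icc 0 1 \ {0}) :=
        Real.continuousOn_log.mono fun t ht => ht.2
      exact hc.comp_continuousOn (continuous_real_toNNReal.comp_continuousOn hlog.neg)
    · intro _
      have h1 : Tendsto (fun t => f (-Real.log t).toNNReal) (𝓝[>] 0) (𝓝 L) :=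
        hL.comp (Real.tendsto_toNNReal_atTop.comp
          (tendsto_neg_atBot_atTop.comp Real.tendsto_log_nhdsGT_zero))
      exact h1.mono_left (nhdsWithin_mono _ fun t ht => lt_of_le_of_ne ht.1.1 (Ne.symm ht.2))
  obtain ⟨p, hp⟩ := exists_polynomial_near_of_continuousOn 0 1 g hg ε hε
  refine ⟨p, fun x => ?_⟩
  have hmem : Real.exp (-x) ∈ Icc (0 : ℝ) 1 :=
    ⟨Real.exp_nonneg _, Real.exp_le_one_iff.2 (neg_nonpos.2 x.2)⟩
  have hgx : g (Real.exp (-x)) = f x := by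
    simp [g]
  have := hp _ hmem
  rwa [hgx] at this

lemma polynomial_eval_exp (p : Polynomial ℝ) (x : ℝ≥0) :
    p.eval (Real.exp (-x))
      = (∑ k ∈ Finset.range (p.natDegree + 1), p.coeff k • expFun k) x := by
  rw [Polynomial.eval_eq_sum_range, coe_sum, Finset.sum_apply]
  refine Finset.sum_congr rfl fun k _ => ?_
  rw [coe_smul]
  beta_reduce
  rw [expFun_apply (Nat.cast_nonneg k), smul_eq_mul, ← Real.exp_nat_mul, mul_neg]

lemma IsContExt.exists_bound {f : ℝ≥0 → ℝ} (hf : IsContExt f) : ∃ A, ∀ x, |f x| ≤ A := by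
  obtain ⟨p, hp⟩ := hf.exists_polynomial_near one_pos
  refine ⟨‖∑ k ∈ Finset.range (p.natDegree + 1), p.coeff k • expFun k‖ + 1, fun x => ?_⟩
  have h1 := hp x
  rw [polynomial_eval_exp] at h1
  have h2 := norm_coe_le_norm (∑ k ∈ Finset.range (p.natDegree + 1), p.coeff k • expFun k) x
  rw [Real.norm_eq_abs] at h2
  rw [abs_lt] at h1
  rw [abs_le] at h2 ⊢
  constructor <;> linarith

/-- Every function of `C([0, ∞])` is a uniform limit of functions `(1 - L) g`, with `g` a sum of
exponentials. -/
lemma IsContExt.exists_resolvent_near {f : ℝ≥0 → ℝ} (hf : IsContExt f)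
    (hcont : ∀ u, 0 < u → ContinuousAt ψ u)
    (hpos : ∀ u, 0 < u → 0 < ψ u) (hmono : ∀ u v, 0 < u → u ≤ v → ψ u ≤ ψ v) (hδ : 0 ≤ δ)
    {ε : ℝ} (hε : 0 < ε) :
    ∃ (k : ℕ) (c l : Fin k → ℝ), (∀ i, 0 ≤ l i) ∧ ∀ x : ℝ≥0,
      |f x - (expSum c l x - ∑ i, c i * (((x : ℝ) * (l i * ψ (l i)) - δ * l i)
          * Real.exp (-(l i * x))))| < ε := by
  obtain ⟨p, hp⟩ := hf.exists_polynomial_near (half_pos hε)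
  set Q : ℝ≥0 →ᵇ ℝ := ∑ k ∈ Finset.range (p.natDegree + 1), p.coeff k • expFun k with hQ
  have hQmem : Q ∈ resolventClosure ψ δ := Submodule.sum_mem _ fun k _ =>
    Submodule.smul_mem _ _ (expFun_mem_resolventClosure hcont hpos hmono hδ (Nat.cast_nonneg k))
  obtain ⟨F, hF, hdist⟩ := Metric.mem_closure_iff.1 hQmem (ε / 2) (half_pos hε)
  obtain ⟨k, c, g, rfl⟩ := Submodule.mem_span_set'.1 hF
  choose l hl hg using fun i => (g i).2
  refine ⟨k, c, l, hl, fun x => ?_⟩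
  have h1 := hp x
  have h2 := (dist_coe_le_dist x).trans_lt hdist
  rw [polynomial_eval_exp, ← hQ] at h1
  have h3 : (∑ i, c i • (g i : ℝ≥0 →ᵇ ℝ)) x
      = expSum c l x - ∑ i, c i * (((x : ℝ) * (l i * ψ (l i)) - δ * l i)
          * Real.exp (-(l i * x))) := by
    rw [coe_sum, Finset.sum_apply, expSum, ← Finset.sum_sub_distrib]
    refine Finset.sum_congr rfl fun i _ => ?_
    rw [coe_smul, hg i]
    beta_reduce
    rw [resolventExp_apply _ _ (hl i), smul_eq_mul]
    ring
  rw [h3, Real.dist_eq] at h2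
  rw [abs_lt] at h1 h2 ⊢
  constructor <;> linarith

end

/-! ### Sums of exponentials form a core -/

section

variable {a b C δ : ℝ} {n : Measure ℝ} {P : ℝ≥0 → Kernel ℝ≥0 ℝ≥0} {μ : Measure ℝ≥0}

lemma generator_eq_of_tendstoUniformly {f h : ℝ≥0 → ℝ}
    (hf : TendstoUniformly (fun (t : ℝ≥0) x => (semigroupOp P t f x - f x) / (t : ℝ)) h
      (𝓝[>] 0)) : generator P f = h :=
  funext fun x => (hf.tendsto_at x).limUnder_eq

lemma eventually_generator {f : ℝ≥0 → ℝ} (hf : f ∈ generatorDomain P) {ε : ℝ} (hε : 0 < ε) :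
    ∀ᶠ t : ℝ≥0 in 𝓝[>] 0,
      ∀ x, |generator P f x - (semigroupOp P t f x - f x) / (t : ℝ)| < ε := by
  obtain ⟨_, h, hh⟩ := hf
  rw [generator_eq_of_tendstoUniformly hh]
  exact Metric.tendstoUniformly_iff.1 hh ε hε

lemma IsContExt.sub {f g : ℝ≥0 → ℝ} (hf : IsContExt f) (hg : IsContExt g) :
    IsContExt fun x => f x - g x := by
  obtain ⟨hfc, L, hL⟩ := hf
  obtain ⟨hgc, M, hM⟩ := hg
  exact ⟨hfc.sub hgc, L - M, hL.sub hM⟩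

lemma IsContExt.div_const {f : ℝ≥0 → ℝ} (hf : IsContExt f) (r : ℝ) :
    IsContExt fun x => f x / r := by
  obtain ⟨hfc, L, hL⟩ := hf
  exact ⟨hfc.div_const r, L / r, hL.div_const r⟩

lemma IsFellerTransition.isContExt_quotient (hP : IsFellerTransition P) {f : ℝ≥0 → ℝ}
    (hf : IsContExt f) (t : ℝ≥0) :
    IsContExt fun x => (semigroupOp P t f x - f x) / (t : ℝ) :=
  ((hP.feller t f hf).sub hf).div_const t

lemma IsContExt.integrable {f : ℝ≥0 → ℝ} (hf : IsContExt f) (μ : Measure ℝ≥0)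
    [IsFiniteMeasure μ] : Integrable f μ := by
  obtain ⟨A, hA⟩ := hf.exists_bound
  exact (integrable_const A).mono' hf.1.aestronglyMeasurable (ae_of_all _ hA)

lemma IsFellerTransition.semigroupOp_sub (hP : IsFellerTransition P) (t : ℝ≥0)
    {f g : ℝ≥0 → ℝ} (hf : IsContExt f) (hg : IsContExt g) (x : ℝ≥0) :
    semigroupOp P t (fun x => f x - g x) x = semigroupOp P t f x - semigroupOp P t g x := by
  have := hP.markov t
  exact integral_sub (hf.integrable _) (hg.integrable _)

lemma IsFellerTransition.abs_semigroupOp_le (hP : IsFellerTransition P) (t : ℝ≥0)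
    {f : ℝ≥0 → ℝ} {M : ℝ} (hM : ∀ x, |f x| ≤ M) (x : ℝ≥0) : |semigroupOp P t f x| ≤ M := by
  have := hP.markov t
  have := norm_integral_le_of_norm_le_const (f := f) (μ := P t x) (ae_of_all _ fun y => hM y)
  simpa [semigroupOp] using this

/-- Dissipativity of the generator: `‖f - g‖ ≤ ‖(1 - L) (f - g)‖`. -/
lemma IsFellerTransition.abs_sub_le (hP : IsFellerTransition P) {f g : ℝ≥0 → ℝ}
    (hf : f ∈ generatorDomain P) (hg : g ∈ generatorDomain P) {η : ℝ}
    (h : ∀ x, |(f x - generator P f x) - (g x - generator P g x)| ≤ η) (x : ℝ≥0) :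
    |f x - g x| ≤ η := by
  obtain ⟨A, hA⟩ := (hf.1.sub hg.1).exists_bound
  have hbdd : BddAbove (range fun x => |f x - g x|) := ⟨A, by rintro _ ⟨x, rfl⟩; exact hA x⟩
  set M := ⨆ x, |f x - g x| with hMdef
  have hM : ∀ x, |f x - g x| ≤ M := fun x => le_ciSup hbdd x
  refine (hM x).trans (le_of_forall_pos_le_add fun ε hε => ?_)
  obtain ⟨t, ⟨h1, h2⟩, ht⟩ := (((eventually_generator hf (half_pos hε)).and
    (eventually_generator hg (half_pos hε))).and self_mem_nhdsWithin).exists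
  have ht : (0 : ℝ) < t := ht
  have key : ∀ x, |f x - g x| ≤ (t * (η + ε) + M) / (t + 1) := by
    intro x
    have h3 := hP.abs_semigroupOp_le t hM x
    rw [hP.semigroupOp_sub t hf.1 hg.1] at h3
    have h4 := h x
    have h5 := h1 x
    have h6 := h2 x
    set p := generator P f x
    set q := generator P g x
    have e1 : (semigroupOp P t f x - f x) = t * ((semigroupOp P t f x - f x) / (t : ℝ)) := by
      field_simp
    have e2 : (semigroupOp P t g x - g x) = t * ((semigroupOp P t g x - g x) / (t : ℝ)) := by
      field_simp
    set r := (semigroupOp P t f x - f x) / (t : ℝ)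
    set s := (semigroupOp P t g x - g x) / (t : ℝ)
    rw [le_div_iff₀ (by positivity)]
    -- `(1 + t) (f - g) = T_t (f - g) + t ((f - g) - (T_t (f - g) - (f - g)) / t)`
    have e3 : (f x - g x) * (t + 1)
        = (semigroupOp P t f x - semigroupOp P t g x) + t * ((f x - r) - (g x - s)) := by
      linear_combination e2 - e1
    have h7 : |(f x - r) - (g x - s)| ≤ η + ε := by
      rw [abs_le] at h4 ⊢
      rw [abs_lt] at h5 h6
      constructor <;> linarith
    rw [← abs_of_pos (show (0 : ℝ) < t + 1 by positivity), ← abs_mul, e3]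
    refine (abs_add_le _ _).trans ?_
    rw [abs_mul, abs_of_pos ht]
    nlinarith
  have := ciSup_le key
  rw [← hMdef, le_div_iff₀ (by positivity)] at this
  have h8 : (t : ℝ) * M ≤ t * (η + ε) := by linarith
  exact le_of_mul_le_mul_left h8 ht

/-- The sums of exponentials are dense in the domain for the graph norm. -/
lemma IsBranchingData.exists_graph_near (h : IsBranchingData a b n)
    (hpos : ∀ u, 0 < u → 0 < branchingSymbol a b n u) (hδ : 0 ≤ δ)
    (hP : IsCBCITransition a b n δ P) {f : ℝ≥0 → ℝ} (hf : f ∈ generatorDomain P) {ε : ℝ}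
    (hε : 0 < ε) :
    ∃ p ∈ expSpan, (∀ x : ℝ≥0, |f x - p x| ≤ ε) ∧
      ∀ x : ℝ≥0, |generator P f x - generator P (fun x => p x) x| ≤ ε := by
  have hε4 : 0 < ε / 4 := by positivity
  obtain ⟨t, ht⟩ := (eventually_generator hf hε4).exists
  obtain ⟨k, c, l, hl, hc⟩ := (hf.1.sub
    (hP.isFeller.isContExt_quotient hf.1 t)).exists_resolvent_near
    (ψ := branchingSymbol a b n) (fun u hu => h.continuousAt_branchingSymbol hu) hpos
    (fun u v hu huv => h.branchingSymbol_mono hu.le huv) hδ hε4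
  have hmem := expSum_mem_expSpan (c := c) hl
  have hclose : ∀ x : ℝ≥0, |(f x - generator P f x)
      - (expSum c l x - generator P (fun x => expSum c l x) x)| ≤ ε / 2 := by
    intro x
    have h1 := ht x
    have h2 := hc x
    rw [hP.generator_eq _ hmem, h.cbciOperator_expSum δ hl]
    rw [abs_lt] at h1 h2
    rw [abs_le]
    constructor <;> linarith
  have hsup := hP.isFeller.abs_sub_le hf (hP.mem_domain _ hmem) hclose
  refine ⟨_, hmem, fun x => (hsup x).trans (by linarith), fun x => ?_⟩
  have h1 := hclose x
  have h2 := hsup x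
  rw [abs_le] at h1 h2 ⊢
  constructor <;> linarith

lemma IsFellerTransition.exists_generator_bound (hP : IsFellerTransition P) {f : ℝ≥0 → ℝ}
    (hf : f ∈ generatorDomain P) : ∃ A, ∀ x, |generator P f x| ≤ A := by
  obtain ⟨t, ht⟩ := (eventually_generator hf one_pos).exists
  obtain ⟨A, hA⟩ := (hP.isContExt_quotient hf.1 t).exists_bound
  refine ⟨A + 1, fun x => ?_⟩
  have h1 := ht x
  have h2 := hA x
  rw [abs_lt] at h1
  rw [abs_le] at h2 ⊢
  constructor <;> linarith

lemma IsFellerTransition.continuous_generator (hP : IsFellerTransition P) {f : ℝ≥0 → ℝ}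
    (hf : f ∈ generatorDomain P) : Continuous (generator P f) := by
  obtain ⟨hfc, h, hh⟩ := hf
  rw [generator_eq_of_tendstoUniformly hh]
  exact hh.continuous (Eventually.of_forall fun t => (hP.isContExt_quotient hfc t).1).frequently

/-- The energy form is continuous for the graph norm. -/
lemma IsFellerTransition.tendsto_energyForm (hP : IsFellerTransition P)
    [IsProbabilityMeasure μ] {f g : ℝ≥0 → ℝ} {F G : ℕ → ℝ≥0 → ℝ}
    (hf : f ∈ generatorDomain P) (hg : g ∈ generatorDomain P)
    (hF : ∀ k, F k ∈ generatorDomain P) (hG : ∀ k, G k ∈ generatorDomain P)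
    (hFf : ∀ k x, |generator P f x - generator P (F k) x| ≤ 1 / ((k : ℝ) + 1))
    (hGg : ∀ k x, |g x - G k x| ≤ 1 / ((k : ℝ) + 1)) :
    Tendsto (fun k => energyForm P μ (F k) (G k)) atTop (𝓝 (energyForm P μ f g)) := by
  obtain ⟨A, hA⟩ := hP.exists_generator_bound hf
  obtain ⟨B, hB⟩ := hg.1.exists_bound
  have hle1 : ∀ k : ℕ, 1 / ((k : ℝ) + 1) ≤ 1 := fun k => by
    rw [div_le_one (by positivity)]
    linarith [Nat.cast_nonneg (α := ℝ) k]
  have hconv : ∀ {u : ℝ} {v : ℕ → ℝ}, (∀ k, |u - v k| ≤ 1 / ((k : ℝ) + 1)) →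
      Tendsto v atTop (𝓝 u) := by
    intro u v huv
    refine tendsto_iff_dist_tendsto_zero.2 (squeeze_zero (fun k => dist_nonneg) (fun k => ?_)
      tendsto_one_div_add_atTop_nhds_zero_nat)
    rw [dist_comm, Real.dist_eq]
    exact huv k
  refine (tendsto_integral_of_dominated_convergence (fun _ => (A + 1) * (B + 1)) (fun k => ?_)
    (integrable_const _) (fun k => ae_of_all _ fun x => ?_) (ae_of_all _ fun x => ?_)).neg
  · exact ((hP.continuous_generator (hF k)).mul (hG k).1.1).aestronglyMeasurable
  · have h1 := hFf k x
    have h2 := hGg k x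
    have h3 := hA x
    have h4 := hB x
    have h5 := hle1 k
    have h6 : |generator P (F k) x| ≤ A + 1 := by
      rw [abs_le] at *
      constructor <;> linarith
    have h7 : |G k x| ≤ B + 1 := by
      rw [abs_le] at *
      constructor <;> linarith
    rw [norm_mul]
    exact mul_le_mul h6 h7 (abs_nonneg _) ((abs_nonneg _).trans h6)
  · exact (hconv fun k => hFf k x).mul (hconv fun k => hGg k x)

/-- The sector inequality passes from sums of exponentials to the whole domain. -/
lemma IsBranchingData.sectorConstant_le (h : IsBranchingData a b n)
    (hpos : ∀ u, 0 < u → 0 < branchingSymbol a b n u) (hδ : 0 ≤ δ)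
    (hP : IsCBCITransition a b n δ P) [IsProbabilityMeasure μ] {K : ℝ} (hK : 0 ≤ K)
    (H : ∀ f ∈ expSpan, ∀ g ∈ expSpan, energyForm P μ (fun x => f x) (fun x => g x)
      ≤ K * √(energyForm P μ (fun x => f x) (fun x => f x))
        * √(energyForm P μ (fun x => g x) (fun x => g x))) :
    sectorConstant (generatorDomain P) (energyForm P μ) ≤ ENNReal.ofReal K := by
  refine iInf₂_le K.toNNReal fun f hf g hg => ?_
  rw [Real.coe_toNNReal K hK]
  have hk : ∀ k : ℕ, 0 < 1 / ((k : ℝ) + 1) := fun k => by positivity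
  choose p hp hfp hLp using fun k => h.exists_graph_near hpos hδ hP hf (hk k)
  choose q hq hgq hLq using fun k => h.exists_graph_near hpos hδ hP hg (hk k)
  have hpD := fun k => hP.mem_domain _ (hp k)
  have hqD := fun k => hP.mem_domain _ (hq k)
  exact le_of_tendsto_of_tendsto'
    (hP.isFeller.tendsto_energyForm hf hg hpD hqD hLp hgq)
    (((hP.isFeller.tendsto_energyForm hf hf hpD hpD hLp hfp).sqrt.const_mul K).mul
      (hP.isFeller.tendsto_energyForm hg hg hqD hqD hLq hgq).sqrt)
    fun k => H _ (hp k) _ (hq k)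

end

end CBCI

theorem theorem3p3 (a b : ℝ) (n Λ : Measure ℝ) (ν : ℝ → Measure ℝ≥0) (C : ℝ)
    (hdata : CBCI.IsBranchingData a b n)
    (hΦ : CBCI.laplaceExponent a b n 1 < ⊤)
    (hΛ : CBCI.IsLevyMeasure Λ)
    (hΦΛ : ∀ l : ℝ, 0 ≤ l →
      CBCI.laplaceExponent a b n l = ∫⁻ y, ENNReal.ofReal (1 - Real.exp (-(l * y))) ∂Λ)
    (hν : ∀ δ : ℝ, 0 < δ → CBCI.HasLaplaceExponent (ν δ)
      fun l => δ * (CBCI.laplaceExponent a b n l).toReal)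
    (hC : 0 < C) :
    ((∀ δ : ℝ, 0 < δ → CBCI.CauchySchwarzBound n (CBCI.toLine (ν δ)) C) ↔
        CBCI.CauchySchwarzBound n Λ C) ∧
      (0 < a → ∀ δ : ℝ, 0 < δ → CBCI.CauchySchwarzBound n (CBCI.toLine (ν δ)) C →
        ∀ P : ℝ≥0 → Kernel ℝ≥0 ℝ≥0, CBCI.IsCBCITransition a b n δ P →
          CBCI.sectorConstant (CBCI.generatorDomain P) (CBCI.energyForm P (ν δ)) ≤
            ENNReal.ofReal (1 + √(2 * C / a))) := by
  have hpos : ∀ u, 0 < u → 0 < CBCI.branchingSymbol a b n u :=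
    fun u hu => hdata.branchingSymbol_pos hΦ hu
  have htilt := fun δ hδ => hdata.isTilted hΛ hΦΛ (hν δ hδ)
  refine ⟨⟨hdata.bound_levy hΛ htilt,
    fun H δ hδ => hdata.bound_of_bound_levy hΛ hC.le (htilt δ hδ) H⟩, ?_⟩
  intro ha δ hδ H P hP
  have := (hν δ hδ).1
  refine hdata.sectorConstant_le hpos hδ.le hP (by positivity) fun f hf g hg =>
    hdata.energyForm_le (hν δ hδ) (fun s hs => ?_) hP ha hC H hf hg
  rw [(htilt δ hδ).sizeBiased_eq s hs, hdata.sizeBiased_levy hΛ hΦΛ hs]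
  have := (hpos s hs).ne'
  field_simp
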